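/- Notation. Fix a radial $\varphi\in\mathcal S(\mathbb R^3)$ supported in $\{3/4\le|\xi|\le 8/3\}$ with $\sum_{j\in\mathbb Z}\varphi(2^{-j}\xi)=1$ for all $\xi\ne0$, and set $\Delta_j=\varphi(2^{-j}D)$, $D=\nabla/i$. Let $\mathcal Z$ be the space of $f\in\mathcal S(\mathbb R^3)$ with $D^\alpha\hat f(0)=0$ for all multi-indices $\alpha$, let $\mathcal Z'$ be its dual (tempered distributions modulo polynomials), and for (vector-valued) $f\in\mathcal Z'$ let $\|f\|_{\dot B^{1/2}_{2,\infty}}=\sup_{j\in\mathbb Z}2^{j/2}\|\Delta_jf\|_{L^2}$; $\dot B^{1/2}_{2,\infty}$ is the set of $f\in\mathcal Z'$ for which this is finite. For $T>0$, $L^\infty_T$ refers to the time interval $(0,T)$; $L^\infty_T(\dot B^{1/2}_{2,\infty})$ consists of the weakly measurable functions of time with finite norm $\|u\|_{L^\infty_T\dot B^{1/2}_{2,\infty}}=\operatorname{ess\,sup}_{0<t<T}\|u(t)\|_{\dot B^{1/2}_{2,\infty}}$. For a viscosity $\nu>0$ and a rotation speed $\Omega\in\mathbb R$ let $\mathcal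 G(t)$ be the Stokes--Coriolis semigroup, i.e. the Fourier multiplier with symbol $$e^{-\nu|\xi|^2t}\Big(\cos\big(\Omega\tfrac{\xi_3}{|\xi|}t\big)I+\sin\big(\Omega\tfrac{\xi_3}{|\xi|}t\big)R(\xi)\Big),\qquad R(\xi)=\frac1{|\xi|}\begin{pmatrix}0&\xi_3&-\xi_2\\-\xi_3&0&\xi_1\\ \xi_2&-\xi_1&0\end{pmatrix},$$ let $\mathbb P$ be the Helmholtz projection, with symbol $I-\xi\xi^{\mathsf T}/|\xi|^2$, and let $$B(u,v)(t)=\int_0^t\mathcal G(t-\tau)\,\mathbb P\,\nabla\cdot(u\otimes v)(\tau)\,d\tau\quad\text{in }\mathcal Z',\qquad (\nabla\cdot(u\otimes v))_k=\sum_l\partial_l(u_lv_k),$$ where the products are those of the functions $\sum_j\Delta_ju$ and $\sum_j\Delta_jv$ (series which converge almost everywhere for elements of $\dot B^{1/2}_{2,\infty}$). Proposition. Let $\nu>0$ and $c>0$. There is a constant $C$, depending only on $\nu$, $c$ and $\varphi$ (in particular not on $\Omega$, $T$, $u$, $v$), such that for all $\Omega\in\mathbb R$, all $T>0$ and all $u,v\in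 L^\infty_T(\dot B^{1/2}_{2,\infty})$, $B(u,v)(t)$ is well defined in $\mathcal Z'$ for every $t\in[0,T]$, $B(u,v)\in L^\infty_T(\dot B^{1/2}_{2,\infty})$, and $$\|B(u,v)\|_{L^\infty_T\dot B^{1/2}_{2,\infty}}\le C\,\|u\|_{L^\infty_T\dot B^{1/2}_{2,\infty}}\;\sup_{j\in\mathbb Z}\Big(\omega_{j,T}\,2^{j/2}\,\|\Delta_jv\|_{L^\infty_TL^2}\Big),$$ where $$\omega_{j,T}=\sup_{k\ge j}e_{k,T}\,2^{(j-k)/2},\qquad e_{k,T}=1-e^{-c2^{2k}T}.$$ -/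

import Mathlib

open MeasureTheory SchwartzMap FourierTransform
open scoped ENNReal NNReal

noncomputable section

/-- Physical (and frequency) space. -/
abbrev R3 : Type := EuclideanSpace ℝ (Fin 3)

/-- Values of vector fields, with the Euclidean norm. Real fields are the special case of fields
with real components. -/
abbrev C3 : Type := EuclideanSpace ℂ (Fin 3)

/-! ### Littlewood-Paley decomposition -/

/-- A radial Schwartz function supported in `3/4 ≤ |ξ| ≤ 8/3` whose dyadic dilates sum to `1`
away from the origin. -/
structure LPCutoff where
  φ : 𝓢(R3, ℂ)
  radial : ∀ ξ η : R3, ‖ξ‖ = ‖η‖ → φ ξ = φ η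
  support : ∀ ξ : R3, φ ξ ≠ 0 → 3 / 4 ≤ ‖ξ‖ ∧ ‖ξ‖ ≤ 8 / 3
  sum_eq_one : ∀ ξ : R3, ξ ≠ 0 → HasSum (fun j : ℤ => φ ((2 : ℝ) ^ (-j) • ξ)) 1

/-- The space `𝒵` of Schwartz functions whose Fourier transform vanishes to infinite order at the
origin, with the topology induced by the Schwartz space. -/
def ZSpace : Submodule ℂ 𝓢(R3, ℂ) where
  carrier := {f | ∀ n : ℕ, iteratedFDeriv ℝ n (⇑(𝓕 f : 𝓢(R3, ℂ))) 0 = 0}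
  zero_mem' := by
    intro n
    have h : (⇑(𝓕 (0 : 𝓢(R3, ℂ)) : 𝓢(R3, ℂ))) = fun _ => (0 : ℂ) := by
      ext x
      simp [FourierTransform.fourier_zero]
    rw [h]
    simp
  add_mem' := by
    intro f g hf hg n
    have h : (⇑(𝓕 (f + g) : 𝓢(R3, ℂ))) = (⇑(𝓕 f : 𝓢(R3, ℂ))) + (⇑(𝓕 g : 𝓢(R3, ℂ))) := by
      ext x
      simp [FourierTransform.fourier_add]
    rw [h, iteratedFDeriv_add ((𝓕 f : 𝓢(R3, ℂ)).smooth n) ((𝓕 g : 𝓢(R3, ℂ)).smooth n), Pi.add_apply, hf n, hg n,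
      add_zero]
  smul_mem' := by
    intro c f hf n
    have h : (⇑(𝓕 (c • f) : 𝓢(R3, ℂ))) = c • (⇑(𝓕 f : 𝓢(R3, ℂ))) := by
      ext x
      simp [FourierTransform.fourier_smul]
    rw [h, iteratedFDeriv_const_smul_apply ((𝓕 f : 𝓢(R3, ℂ)).smooth n).contDiffAt, hf n, smul_zero]

/-- The dual `𝒵'` of `𝒵` (tempered distributions modulo polynomials), for vector fields. -/
abbrev ZDual : Type := ZSpace →L[ℂ] C3

namespace LPCutoff

/-- The symbol of `φ(2^{-j} D)`, `D = ∇ / i`. With the Fourier transform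
`∫ e^{-2π i ⟨x, ξ⟩} f(x) dx`, the operator `D` is multiplication by `2π ξ`. -/
def symbol (Φ : LPCutoff) (j : ℤ) (ξ : R3) : ℂ :=
  Φ.φ ((2 : ℝ) ^ (-j) • (2 * Real.pi) • ξ)

theorem symbol_hasTemperateGrowth (Φ : LPCutoff) (j : ℤ) :
    (Φ.symbol j).HasTemperateGrowth := by
  have h1 : (⇑Φ.φ).HasTemperateGrowth := Φ.φ.hasTemperateGrowth
  have h2 : (fun ξ : R3 => (2 : ℝ) ^ (-j) • (2 * Real.pi) • ξ).HasTemperateGrowth := by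
    fun_prop
  exact h1.comp h2

/-- `Δ_j` on Schwartz functions. -/
def deltaS (Φ : LPCutoff) (j : ℤ) : 𝓢(R3, ℂ) →L[ℂ] 𝓢(R3, ℂ) :=
  SchwartzMap.fourierMultiplierCLM ℂ (Φ.symbol j)

theorem deltaS_mem (Φ : LPCutoff) (j : ℤ) (f : 𝓢(R3, ℂ)) : Φ.deltaS j f ∈ ZSpace := by
  intro n
  have h1 : (⇑(𝓕 (Φ.deltaS j f) : 𝓢(R3, ℂ))) = fun ξ => Φ.symbol j ξ • (𝓕 f : 𝓢(R3, ℂ)) ξ := by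
    ext ξ
    rw [deltaS, SchwartzMap.fourierMultiplierCLM_apply, FourierTransform.fourier_fourierInv_eq,
      SchwartzMap.smulLeftCLM_apply_apply (Φ.symbol_hasTemperateGrowth j)]
  have hc : Continuous (fun ξ : R3 => ‖(2 : ℝ) ^ (-j) • (2 * Real.pi) • ξ‖) := by fun_prop
  have h2 : ∀ᶠ ξ : R3 in nhds 0, ‖(2 : ℝ) ^ (-j) • (2 * Real.pi) • ξ‖ < 3 / 4 := by
    refine hc.continuousAt.eventually_lt_const ?_
    simp
  have h3 : (⇑(𝓕 (Φ.deltaS j f) : 𝓢(R3, ℂ))) =ᶠ[nhds 0] fun _ => (0 : ℂ) := by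
    rw [h1]
    filter_upwards [h2] with ξ hξ
    have : Φ.symbol j ξ = 0 := by
      by_contra hne
      exact absurd (Φ.support _ hne).1 (not_le.mpr hξ)
    simp [this]
  rw [(h3.iteratedFDeriv ℝ n).eq_of_nhds]
  simp

/-- `Δ_j`, which maps Schwartz functions into `𝒵`. -/
def deltaZ (Φ : LPCutoff) (j : ℤ) : 𝓢(R3, ℂ) →L[ℂ] ZSpace :=
  (Φ.deltaS j).codRestrict ZSpace (Φ.deltaS_mem j)

/-- `Δ_j f` for `f ∈ 𝒵'`, by transposition: a tempered distribution (`φ` is even, so `Δ_j` is its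
own transpose). -/
def delta (Φ : LPCutoff) (j : ℤ) (f : ZDual) : 𝓢'(R3, C3) :=
  ContinuousLinearMap.toPointwiseConvergenceCLM _ _ _ _ (f ∘L Φ.deltaZ j)

end LPCutoff

/-- The `L²` norm of a tempered distribution: `∞` if it is not an `L²` function. -/
def l2Norm (f : 𝓢'(R3, C3)) : ℝ≥0∞ :=
  ⨅ g : Lp C3 2 (volume : Measure R3), ⨅ _ : (g : 𝓢'(R3, C3)) = f, ‖g‖ₑ

open Classical in
/-- The `L²` function that a tempered distribution is given by (`0` if there is none). -/
def l2Rep (f : 𝓢'(R3, C3)) : Lp C3 2 (volume : Measure R3) :=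
  if h : ∃ g : Lp C3 2 (volume : Measure R3), (g : 𝓢'(R3, C3)) = f then h.choose else 0

/-- The norm of `Ḃ^s_{2,∞}`. -/
def besovNorm (Φ : LPCutoff) (s : ℝ) (f : ZDual) : ℝ≥0∞ :=
  ⨆ j : ℤ, (2 : ℝ≥0∞) ^ ((j : ℝ) * s) * l2Norm (Φ.delta j f)

/-- The norm of `L^∞_T(Ḃ^s_{2,∞})`. -/
def linftyBesovNorm (Φ : LPCutoff) (s T : ℝ) (u : ℝ → ZDual) : ℝ≥0∞ :=
  essSup (fun t => besovNorm Φ s (u t)) (volume.restrict (Set.Ioo 0 T))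

/-- `u ∈ L^∞_T(Ḃ^s_{2,∞})`, with weak measurability in time. -/
structure MemLinftyBesov (Φ : LPCutoff) (s T : ℝ) (u : ℝ → ZDual) : Prop where
  measurable : ∀ ψ : ZSpace,
    AEStronglyMeasurable (fun t => u t ψ) (volume.restrict (Set.Ioo 0 T))
  finite : linftyBesovNorm Φ s T u < ∞

/-- The function `∑_j Δ_j f` in the class modulo polynomials `f`. For `f ∈ Ḃ^{1/2}_{2,∞}` the
`Δ_j f` are in `L²` and the series converges absolutely almost everywhere. -/
def realization (Φ : LPCutoff) (f : ZDual) (x : R3) : C3 :=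
  ∑' j : ℤ, (l2Rep (Φ.delta j f) : R3 → C3) x

/-! ### The Stokes-Coriolis semigroup and the bilinear operator -/

/-- The matrix `R(ξ)`. -/
def rotMatrix (ξ : R3) : Matrix (Fin 3) (Fin 3) ℝ :=
  !![0, ξ 2 / ‖ξ‖, -(ξ 1 / ‖ξ‖);
     -(ξ 2 / ‖ξ‖), 0, ξ 0 / ‖ξ‖;
     ξ 1 / ‖ξ‖, -(ξ 0 / ‖ξ‖), 0]

/-- The symbol of the Stokes-Coriolis semigroup `𝒢(t)`, in the variable `ξ` of `D = ∇ / i`. -/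
def semigroupSymbol (ν Ω t : ℝ) (ξ : R3) : Matrix (Fin 3) (Fin 3) ℝ :=
  Real.exp (-ν * ‖ξ‖ ^ 2 * t) •
    (Real.cos (Ω * (ξ 2 / ‖ξ‖) * t) • (1 : Matrix (Fin 3) (Fin 3) ℝ)
      + Real.sin (Ω * (ξ 2 / ‖ξ‖) * t) • rotMatrix ξ)

/-- The symbol of the Helmholtz projection. -/
def helmholtzSymbol (ξ : R3) : Matrix (Fin 3) (Fin 3) ℝ :=
  1 - (‖ξ‖ ^ 2)⁻¹ • Matrix.vecMulVec (fun i => ξ i) (fun i => ξ i)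

/-- The symbol of `w ↦ (𝒢(t) ℙ ∇·w)_i` with respect to the entry `w_{lk}` of a matrix field `w`,
where `(∇·w)_k = ∑_l ∂_l w_{lk}`. -/
def duhamelSymbol (ν Ω t : ℝ) (i l k : Fin 3) (ξ : R3) : ℂ :=
  (((semigroupSymbol ν Ω t ξ * helmholtzSymbol ξ) i k : ℝ) : ℂ) * (Complex.I * ((ξ l : ℝ) : ℂ))

/-- The transpose `m(-D) ψ` of the Fourier multiplier `m(D)` on a test function. -/
def transposedMultiplier (m : R3 → ℂ) (ψ : 𝓢(R3, ℂ)) : R3 → ℂ :=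
  𝓕⁻ (fun ξ : R3 => m (-((2 * Real.pi) • ξ)) * (𝓕 ψ : 𝓢(R3, ℂ)) ξ)

/-- The integrand over space in the pairing `⟨𝒢(s) ℙ ∇·(f ⊗ g), ψ⟩`, for functions `f, g`
with values in `ℂ³`; its `i`-th component is `∑_{l,k} f_l g_k · (m_{ilk}(-D) ψ)`. -/
def duhamelIntegrand (ν Ω s : ℝ) (f g : R3 → C3) (ψ : 𝓢(R3, ℂ)) (x : R3) : C3 :=
  WithLp.toLp 2 fun i =>
    ∑ l, ∑ k, transposedMultiplier (duhamelSymbol ν Ω s i l k) ψ x * (f x l * g x k)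

/-- `b = B(u,v)(t) = ∫_0^t 𝒢(t-τ) ℙ ∇·(u ⊗ v)(τ) dτ` in `𝒵'`, tested against all `ψ ∈ 𝒵`, with all
integrals absolutely convergent. This determines `b`. -/
def IsBilinear (Φ : LPCutoff) (ν Ω : ℝ) (u v : ℝ → ZDual) (t : ℝ) (b : ZDual) : Prop :=
  ∀ ψ : ZSpace,
    (∀ᵐ τ ∂(volume.restrict (Set.Ioo 0 t)),
      Integrable (duhamelIntegrand ν Ω (t - τ)
        (realization Φ (u τ)) (realization Φ (v τ)) (ψ : 𝓢(R3, ℂ)))) ∧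
    IntegrableOn (fun τ => ∫ x, duhamelIntegrand ν Ω (t - τ)
        (realization Φ (u τ)) (realization Φ (v τ)) (ψ : 𝓢(R3, ℂ)) x) (Set.Ioo 0 t) ∧
    b ψ = ∫ τ in Set.Ioo 0 t, ∫ x, duhamelIntegrand ν Ω (t - τ)
        (realization Φ (u τ)) (realization Φ (v τ)) (ψ : 𝓢(R3, ℂ)) x

/-! ### The weights -/

/-- `e_{k,T} = 1 - e^{-c 2^{2k} T}`. -/
def eWeight (c T : ℝ) (k : ℤ) : ℝ := 1 - Real.exp (-c * (2 : ℝ) ^ (2 * k) * T)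

/-- `ω_{j,T} = sup_{k ≥ j} e_{k,T} 2^{(j-k)/2}`. -/
def omegaWeight (c T : ℝ) (j : ℤ) : ℝ :=
  ⨆ k : Set.Ici j, eWeight c T k * (2 : ℝ) ^ (((j : ℝ) - ((k : ℤ) : ℝ)) / 2)

/-- `‖ω_{j,T} 2^{j/2} ‖Δ_j v‖_{L^∞_T L²}‖_{ℓ^∞}`. -/
def weightedNorm (Φ : LPCutoff) (c T : ℝ) (v : ℝ → ZDual) : ℝ≥0∞ :=
  ⨆ j : ℤ, ENNReal.ofReal (omegaWeight c T j) * (2 : ℝ≥0∞) ^ ((j : ℝ) / 2) *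
    essSup (fun t => l2Norm (Φ.delta j (v t))) (volume.restrict (Set.Ioo 0 T))

end

noncomputable section

/-! ### The Fourier transform on `L¹ ∩ L²` -/

section FourierBasics

variable {V : Type*} [NormedAddCommGroup V] [InnerProductSpace ℂ V]

/-! The proof is by duality, one dyadic block at a time: if `B(u,v)(t)` tested against `Δ_j ψ` is at
most a constant times `2^{-j/2} ‖ψ‖_{L²}`, uniformly in `j`, then it is bounded in the Besov space
(`besovNorm_le_of_delta_bound`). Testing moves the multiplier onto `Δ_j ψ`. The result has
frequencies of size `2^j` and `L²` norm at most a constant times `2^j exp(-(9/16) ν 2^{2j} (t-τ))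
‖ψ‖_{L²}`. The rotation enters only through a sine and a cosine, so the constant does not see `Ω`.

What remains at each time is a trilinear form, expanded into products `Δ_k u Δ_m v`. If both `k` and
`m` lie below `j - 2`, the product has no frequencies of size `2^j` and the term vanishes. In all
other terms Hölder and Bernstein give geometric decay in `|k - (j-2)|` and `|m - (j-2)|`
(`dyadic_term_le`, `norm_trilinear_localized_le`). The decay survives when `‖Δ_m v‖` is only bounded
by `W 2^{-m/2} 2^{(j-m)/2}` for `m < j`, and the weights use exactly this room: `ω_{m,T} ≥ e_{j,T}
2^{-max(j-m,0)/2}`, so the weighted norm of `v` yields such a bound with `W` equal to that norm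
divided by `e_{j,T}`.

The time integral of the exponential is at most a constant times `2^{-2j} e_{j,T}`
(`integral_exp_le`). The factors `e_{j,T}` cancel, and `2^{j/2} 2^j 2^{-2j} = 2^{-j/2}`.

For existence, the same expansion centred at frequency `1` converges absolutely for every Schwartz
test function, with a bound by a continuous seminorm. Measurability in time rests on Pettis'
theorem: weak measurability of `u` makes each block strongly measurable with values in `L²`. -/

theorem integral_fourierInv_smul_of_integrable [CompleteSpace V] {f : R3 → ℂ} {g : R3 → V}
    (hf : Integrable f) (hg : Integrable g) :
    ∫ ξ, 𝓕⁻ f ξ • g ξ = ∫ x, f x • 𝓕⁻ g x := by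
  have hflip : (-innerₗ R3 : R3 →ₗ[ℝ] R3 →ₗ[ℝ] ℝ).flip = -innerₗ R3 := by
    ext x y; simp [real_inner_comm]
  have := VectorFourier.integral_fourierIntegral_smul_eq_flip (μ := (volume : Measure R3))
    (ν := (volume : Measure R3)) (e := Real.fourierChar) (L := -innerₗ R3) (f := f) (g := g)
    Real.continuous_fourierChar (continuous_inner (𝕜 := ℝ) (E := R3)).neg hf hg
  rw [hflip] at this
  exact this

theorem continuous_fourierInv_of_integrable {f : R3 → V} (hf : Integrable f) :
    Continuous (𝓕⁻ f : R3 → V) :=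
  VectorFourier.fourierIntegral_continuous Real.continuous_fourierChar
    (continuous_inner (𝕜 := ℝ) (E := R3)).neg hf

theorem norm_fourierInv_le_integral_norm (f : R3 → V) (x : R3) :
    ‖𝓕⁻ f x‖ ≤ ∫ ξ, ‖f ξ‖ :=
  VectorFourier.norm_fourierIntegral_le_integral_norm _ _ _ _ _

theorem eLpNorm_top_fourierInv_le (f : R3 → V) (hf : Integrable f) :
    eLpNorm (𝓕⁻ f : R3 → V) ∞ volume ≤ eLpNorm f 1 volume := by
  rw [eLpNorm_exponent_top]
  refine eLpNormEssSup_le_of_ae_enorm_bound (Filter.Eventually.of_forall fun x => ?_)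
  rw [eLpNorm_one_eq_lintegral_enorm, ← ofReal_norm, ← ofReal_integral_norm_eq_lintegral_enorm hf]
  exact ENNReal.ofReal_le_ofReal (norm_fourierInv_le_integral_norm f x)

/-- On `L¹ ∩ L²` the inverse Fourier transform in `L²` is given by the integral. -/
theorem fourierInv_toLp_ae_eq [CompleteSpace V] {X : R3 → V}
    (h1 : Integrable X) (h2 : MemLp X 2 volume) :
    ((𝓕⁻ (h2.toLp X) : Lp V 2 (volume : Measure R3)) : R3 → V) =ᵐ[volume] (𝓕⁻ X : R3 → V) := by
  -- Both sides are compared on smooth compactly supported functions. On each side the transform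
  -- moves to the test function: for the `L²` transform by its compatibility with tempered
  -- distributions, for the integral by Fubini.
  refine ae_eq_of_integral_contDiff_smul_eq
    ((Lp.memLp _).locallyIntegrable (by norm_num))
    (continuous_fourierInv_of_integrable h1).locallyIntegrable fun g g_smooth g_cpt => ?_
  have hg₁ : HasCompactSupport (Complex.ofRealCLM ∘ g) := g_cpt.comp_left rfl
  have hg₂ : ContDiff ℝ ((⊤ : ℕ∞) : WithTop ℕ∞) (Complex.ofRealCLM ∘ g) := by fun_prop
  set s : 𝓢(R3, ℂ) := hg₁.toSchwartzMap hg₂ with hs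
  have hsg : ∀ x (w : V), g x • w = s x • w := fun x w => by simp [hs]
  have e1 : ∫ x, g x • ((𝓕⁻ (h2.toLp X) : Lp V 2 (volume : Measure R3)) : R3 → V) x
      = ((𝓕⁻ (h2.toLp X) : Lp V 2 (volume : Measure R3)) : 𝓢'(R3, V)) s := by
    rw [Lp.toTemperedDistribution_apply]
    simp_rw [hsg]
  rw [e1, ← Lp.fourierInv_toTemperedDistribution_eq, TemperedDistribution.fourierInv_apply,
    Lp.toTemperedDistribution_apply]
  simp_rw [hsg]
  rw [← integral_fourierInv_smul_of_integrable s.integrable h1]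
  refine integral_congr_ae ?_
  filter_upwards [h2.coeFn_toLp] with x hx
  rw [hx, SchwartzMap.fourierInv_coe]

theorem eLpNorm_two_fourierInv [CompleteSpace V] {X : R3 → V}
    (h1 : Integrable X) (h2 : MemLp X 2 volume) :
    eLpNorm (𝓕⁻ X : R3 → V) 2 volume = eLpNorm X 2 volume := by
  rw [← eLpNorm_congr_ae (fourierInv_toLp_ae_eq h1 h2), ← eLpNorm_congr_ae h2.coeFn_toLp]
  have h : ‖(𝓕⁻ (h2.toLp X) : Lp V 2 (volume : Measure R3))‖ₑ = ‖h2.toLp X‖ₑ := by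
    rw [← ofReal_norm, ← ofReal_norm]
    congr 1
    exact (Lp.fourierTransformₗᵢ R3 V).symm.norm_map _
  rwa [Lp.enorm_def, Lp.enorm_def] at h

theorem memLp_two_fourierInv [CompleteSpace V] {X : R3 → V}
    (h1 : Integrable X) (h2 : MemLp X 2 volume) :
    MemLp (𝓕⁻ X : R3 → V) 2 volume :=
  ⟨(continuous_fourierInv_of_integrable h1).aestronglyMeasurable, by
    rw [eLpNorm_two_fourierInv h1 h2]; exact h2.2⟩

theorem conj_fourierInv (f : R3 → ℂ) (x : R3) :
    (starRingEnd ℂ) (𝓕⁻ f x) = 𝓕⁻ (fun ξ => (starRingEnd ℂ) (f (-ξ))) x := by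
  rw [Real.fourierInv_eq, Real.fourierInv_eq, ← integral_conj,
    ← integral_neg_eq_self (fun v => Real.fourierChar (inner ℝ v x) • (starRingEnd ℂ) (f (-v)))]
  refine integral_congr_ae (Filter.Eventually.of_forall fun v => ?_)
  simp only [Circle.smul_def, smul_eq_mul, map_mul, neg_neg, inner_neg_left]
  rw [← Circle.coe_inv_eq_conj, AddChar.map_neg_eq_inv]

/-- Parseval's identity. -/
theorem integral_fourierInv_mul_fourierInv {Y G : R3 → ℂ} (hY1 : Integrable Y)
    (hY2 : MemLp Y 2 volume) (hG1 : Integrable G) (hG2 : MemLp G 2 volume) :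
    ∫ x, 𝓕⁻ Y x * 𝓕⁻ G x = ∫ ξ, Y ξ * G (-ξ) := by
  -- Unitarity gives Parseval with a conjugate in one slot. This `Z` is chosen so that the conjugate
  -- of `𝓕⁻ Z` is `𝓕⁻ G`.
  set Z : R3 → ℂ := fun ξ => (starRingEnd ℂ) (G (-ξ)) with hZ
  have hmp : MeasurePreserving (fun ξ : R3 => -ξ) volume volume :=
    Measure.measurePreserving_neg volume
  have hZ1 : Integrable Z := by
    have : Integrable (fun ξ => G (-ξ)) := hmp.integrable_comp_of_integrable hG1
    exact (Complex.conjLIE.toContinuousLinearEquiv.toContinuousLinearMap).integrable_comp this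
  have hZ2 : MemLp Z 2 volume := by
    have : MemLp (fun ξ => G (-ξ)) 2 volume := hG2.comp_measurePreserving hmp
    exact (Complex.conjLIE.toContinuousLinearEquiv.toContinuousLinearMap).comp_memLp' this
  have key : inner ℂ (𝓕⁻ (hZ2.toLp Z) : Lp ℂ 2 (volume : Measure R3)) (𝓕⁻ (hY2.toLp Y))
      = inner ℂ (hZ2.toLp Z) (hY2.toLp Y) :=
    (Lp.fourierTransformₗᵢ R3 ℂ).symm.inner_map_map _ _
  rw [L2.inner_def, L2.inner_def] at key
  calc ∫ x, 𝓕⁻ Y x * 𝓕⁻ G x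
      = ∫ x, inner ℂ ((𝓕⁻ (hZ2.toLp Z) : Lp ℂ 2 (volume : Measure R3)) x)
          ((𝓕⁻ (hY2.toLp Y) : Lp ℂ 2 (volume : Measure R3)) x) := by
        refine integral_congr_ae ?_
        filter_upwards [fourierInv_toLp_ae_eq hZ1 hZ2, fourierInv_toLp_ae_eq hY1 hY2] with x h1 h2
        rw [h1, h2, RCLike.inner_apply, conj_fourierInv]
        simp [hZ]
    _ = ∫ ξ, Y ξ * G (-ξ) := by
        rw [key]
        refine integral_congr_ae ?_
        filter_upwards [hZ2.coeFn_toLp, hY2.coeFn_toLp] with x h1 h2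
        rw [h1, h2, RCLike.inner_apply]
        simp [hZ]

theorem fourierInv_comp_sub (F : R3 → ℂ) (ζ x : R3) :
    𝓕⁻ (fun ξ => F (ξ - ζ)) x = Real.fourierChar (inner ℝ ζ x) • 𝓕⁻ F x := by
  simp only [Real.fourierInv_eq, Circle.smul_def]
  rw [← integral_smul,
    ← integral_sub_right_eq_self (fun v => (Real.fourierChar (inner ℝ ζ x) : ℂ) •
      (Real.fourierChar (inner ℝ v x) : ℂ) • F v) ζ]
  refine integral_congr_ae (Filter.Eventually.of_forall fun v => ?_)
  simp only [inner_sub_left, ← mul_smul, ← Circle.coe_mul, ← AddChar.map_add_eq_mul]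
  congr 3
  ring

/-- A product of two functions with small frequencies is orthogonal to one with large
frequencies. -/
theorem integral_fourierInv_mul_mul_eq_zero {X F G : R3 → ℂ} {r s ρ : ℝ}
    (hX : Integrable X) (hF1 : Integrable F) (hF2 : MemLp F 2 volume)
    (hG1 : Integrable G) (hG2 : MemLp G 2 volume)
    (hXs : ∀ ξ, X ξ ≠ 0 → ρ ≤ ‖ξ‖) (hFs : ∀ ξ, F ξ ≠ 0 → ‖ξ‖ ≤ r)
    (hGs : ∀ ξ, G ξ ≠ 0 → ‖ξ‖ ≤ s) (hρ : r + s < ρ) :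
    ∫ x, 𝓕⁻ X x * (𝓕⁻ F x * 𝓕⁻ G x) = 0 := by
  have hfg : Integrable (fun x => 𝓕⁻ F x * 𝓕⁻ G x) :=
    (memLp_two_fourierInv hF1 hF2).integrable_mul (memLp_two_fourierInv hG1 hG2)
  have h := integral_fourierInv_smul_of_integrable hX hfg
  simp only [smul_eq_mul] at h
  rw [h]
  refine integral_eq_zero_of_ae (Filter.Eventually.of_forall fun ζ => ?_)
  by_cases hζ : X ζ = 0
  · simp [hζ]
  have hmp : MeasurePreserving (fun ξ : R3 => ξ - ζ) volume volume :=
    measurePreserving_sub_right volume ζ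
  -- Evaluating at `ζ` multiplies by a character, which translates `F`; Parseval then turns the
  -- transform of the product into a convolution.
  have e : 𝓕⁻ (fun x => 𝓕⁻ F x * 𝓕⁻ G x) ζ = ∫ ξ, F (ξ - ζ) * G (-ξ) := by
    have hP := integral_fourierInv_mul_fourierInv (hmp.integrable_comp_of_integrable hF1)
      (hF2.comp_measurePreserving hmp) hG1 hG2
    simp only [Function.comp_def] at hP
    rw [← hP, Real.fourierInv_eq]
    refine integral_congr_ae (Filter.Eventually.of_forall fun x => ?_)
    simp only [fourierInv_comp_sub, real_inner_comm, smul_mul_assoc]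
  have e0 : ∫ ξ, F (ξ - ζ) * G (-ξ) = 0 := by
    refine integral_eq_zero_of_ae (Filter.Eventually.of_forall fun ξ => ?_)
    by_contra hne
    have h1 := hFs _ (left_ne_zero_of_mul hne)
    have h2 := hGs _ (right_ne_zero_of_mul hne)
    have h3 := hXs _ hζ
    have : ‖ζ‖ ≤ ‖ξ - ζ‖ + ‖-ξ‖ := by
      calc ‖ζ‖ = ‖-((ξ - ζ) + -ξ)‖ := by congr 1; abel
        _ = ‖(ξ - ζ) + -ξ‖ := norm_neg _
        _ ≤ _ := norm_add_le _ _
    linarith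
  simp [e, e0]

/-- Bernstein's inequality on the frequency side. -/
theorem eLpNorm_one_le_of_support {V : Type*} [NormedAddCommGroup V] {F : R3 → V} {S : Set R3}
    (hF : AEStronglyMeasurable F volume) (hS : MeasurableSet S) (h : ∀ ξ, F ξ ≠ 0 → ξ ∈ S) :
    eLpNorm F 1 volume ≤ eLpNorm F 2 volume * volume S ^ (1 / 2 : ℝ) := by
  have hind : S.indicator F = F := Set.indicator_eq_self.mpr fun ξ hξ => h ξ hξ
  have h1 := eLpNorm_le_eLpNorm_mul_rpow_measure_univ (μ := volume.restrict S) (p := 1) (q := 2)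
    (by norm_num) (f := F) hF.restrict
  rw [← eLpNorm_indicator_eq_eLpNorm_restrict hS, ← eLpNorm_indicator_eq_eLpNorm_restrict hS,
    hind] at h1
  convert h1 using 3
  · simp
  · norm_num

theorem integrable_of_support {V : Type*} [NormedAddCommGroup V] {F : R3 → V} {S : Set R3}
    (hF : MemLp F 2 volume)
    (hS : MeasurableSet S) (hS' : volume S ≠ ∞) (h : ∀ ξ, F ξ ≠ 0 → ξ ∈ S) : Integrable F := by
  rw [← memLp_one_iff_integrable]
  refine ⟨hF.1, (eLpNorm_one_le_of_support hF.1 hS h).trans_lt ?_⟩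
  exact ENNReal.mul_lt_top hF.2 (ENNReal.rpow_lt_top_of_nonneg (by norm_num) hS')

end FourierBasics

/-! ### Frequency localisation of the dyadic blocks -/

/-- The frequencies of `Δ_j`, in the normalisation of `𝓕`. -/
def annulus (j : ℤ) : Set R3 :=
  {ξ | 3 / 4 * (2 : ℝ) ^ j ≤ ‖(2 * Real.pi) • ξ‖ ∧ ‖(2 * Real.pi) • ξ‖ ≤ 8 / 3 * (2 : ℝ) ^ j}

theorem isClosed_annulus (j : ℤ) : IsClosed (annulus j) :=
  (isClosed_le continuous_const (continuous_const_smul (2 * Real.pi)).norm).inter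
    (isClosed_le (continuous_const_smul (2 * Real.pi)).norm continuous_const)

theorem neg_mem_annulus {j : ℤ} {ξ : R3} : -ξ ∈ annulus j ↔ ξ ∈ annulus j := by
  simp [annulus]

theorem norm_le_norm_two_pi_smul (ξ : R3) : ‖ξ‖ ≤ ‖(2 * Real.pi) • ξ‖ := by
  rw [norm_smul, Real.norm_of_nonneg (by positivity)]
  nlinarith [norm_nonneg ξ, Real.pi_gt_three]

theorem annulus_subset_closedBall (j : ℤ) :
    annulus j ⊆ Metric.closedBall 0 (8 / 3 * (2 : ℝ) ^ j) := fun ξ hξ => by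
  rw [mem_closedBall_zero_iff]
  exact (norm_le_norm_two_pi_smul ξ).trans hξ.2

/-- The constant in Bernstein's inequality. -/
def bernsteinConst : ℝ :=
  Real.sqrt ((8 / 3) ^ 3 * (volume (Metric.closedBall (0 : R3) 1)).toReal)

theorem bernsteinConst_nonneg : 0 ≤ bernsteinConst := Real.sqrt_nonneg _

theorem volume_annulus_rpow_le (j : ℤ) :
    volume (annulus j) ^ (1 / 2 : ℝ) ≤
      ENNReal.ofReal (bernsteinConst * (2 : ℝ) ^ (3 / 2 * (j : ℝ))) := by
  have hb : volume (Metric.closedBall (0 : R3) 1) ≠ ∞ := measure_closedBall_lt_top.ne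
  have h1 : volume (annulus j) ≤ ENNReal.ofReal ((8 / 3 * (2 : ℝ) ^ j) ^ 3 *
      (volume (Metric.closedBall (0 : R3) 1)).toReal) := by
    refine (measure_mono (annulus_subset_closedBall j)).trans ?_
    rw [Measure.addHaar_closedBall' volume _ (by positivity), ENNReal.ofReal_mul (by positivity),
      ENNReal.ofReal_toReal hb]
    simp
  refine (ENNReal.rpow_le_rpow h1 (by norm_num)).trans ?_
  rw [ENNReal.ofReal_rpow_of_nonneg (by positivity) (by norm_num)]
  refine ENNReal.ofReal_le_ofReal (le_of_eq ?_)
  have e : (8 / 3 * (2 : ℝ) ^ j) ^ 3 * (volume (Metric.closedBall (0 : R3) 1)).toReal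
      = ((8 / 3) ^ 3 * (volume (Metric.closedBall (0 : R3) 1)).toReal) *
        (2 : ℝ) ^ (3 * (j : ℝ)) := by
    have : (2 : ℝ) ^ (3 * (j : ℝ)) = ((2 : ℝ) ^ j) ^ 3 := by
      rw [mul_comm, Real.rpow_mul (by norm_num), Real.rpow_intCast]
      norm_cast
    rw [this]; ring
  rw [e, Real.mul_rpow (by positivity) (by positivity), ← Real.rpow_mul (by norm_num),
    bernsteinConst, Real.sqrt_eq_rpow]
  congr 2
  ring

theorem volume_annulus_ne_top (j : ℤ) : volume (annulus j) ≠ ∞ :=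
  ((measure_mono (annulus_subset_closedBall j)).trans_lt measure_closedBall_lt_top).ne

/-- Bernstein's inequality on an annulus. -/
theorem eLpNorm_one_le_of_annulus {V : Type*} [NormedAddCommGroup V] [InnerProductSpace ℂ V]
    {F : R3 → V} {j : ℤ} (hF : AEStronglyMeasurable F volume)
    (h : ∀ ξ, F ξ ≠ 0 → ξ ∈ annulus j) :
    eLpNorm F 1 volume ≤
      eLpNorm F 2 volume * ENNReal.ofReal (bernsteinConst * (2 : ℝ) ^ (3 / 2 * (j : ℝ))) :=
  (eLpNorm_one_le_of_support hF (isClosed_annulus j).measurableSet h).trans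
    (mul_le_mul_right (volume_annulus_rpow_le j) _)

theorem integrable_of_annulus {V : Type*} [NormedAddCommGroup V] [InnerProductSpace ℂ V]
    {F : R3 → V} {j : ℤ} (hF : MemLp F 2 volume)
    (h : ∀ ξ, F ξ ≠ 0 → ξ ∈ annulus j) : Integrable F :=
  integrable_of_support hF (isClosed_annulus j).measurableSet (volume_annulus_ne_top j) h

namespace LPCutoff

variable (Φ : LPCutoff)

theorem mem_annulus_of_symbol_ne_zero {j : ℤ} {ξ : R3} (h : Φ.symbol j ξ ≠ 0) :
    ξ ∈ annulus j := by
  have h1 := Φ.support _ h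
  rw [norm_smul, Real.norm_of_nonneg (by positivity), zpow_neg, inv_mul_eq_div] at h1
  have h2 : (0 : ℝ) < 2 ^ j := by positivity
  exact ⟨(le_div_iff₀ h2).mp h1.1, (div_le_iff₀ h2).mp h1.2⟩

theorem fourier_deltaS_apply (j : ℤ) (ψ : 𝓢(R3, ℂ)) (ξ : R3) :
    (𝓕 (Φ.deltaS j ψ) : 𝓢(R3, ℂ)) ξ = Φ.symbol j ξ * (𝓕 ψ : 𝓢(R3, ℂ)) ξ := by
  rw [deltaS, SchwartzMap.fourierMultiplierCLM_apply, FourierTransform.fourier_fourierInv_eq,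
    SchwartzMap.smulLeftCLM_apply_apply (Φ.symbol_hasTemperateGrowth j), smul_eq_mul]

theorem deltaS_eq_zero {j : ℤ} {ψ : 𝓢(R3, ℂ)}
    (h : ∀ ξ ∈ annulus j, (𝓕 ψ : 𝓢(R3, ℂ)) ξ = 0) : Φ.deltaS j ψ = 0 := by
  have h1 : (𝓕 (Φ.deltaS j ψ) : 𝓢(R3, ℂ)) = 0 := by
    ext ξ
    rw [fourier_deltaS_apply]
    by_cases hξ : Φ.symbol j ξ = 0
    · simp [hξ]
    · simp [h ξ (Φ.mem_annulus_of_symbol_ne_zero hξ)]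
  have h2 := congrArg (fun f : 𝓢(R3, ℂ) => (𝓕⁻ f : 𝓢(R3, ℂ))) h1
  simpa [FourierTransform.fourierInv_fourier_eq, FourierTransform.fourierInv_zero] using h2

theorem delta_apply (j : ℤ) (f : ZDual) (ψ : 𝓢(R3, ℂ)) :
    Φ.delta j f ψ = f (Φ.deltaZ j ψ) := rfl

end LPCutoff

theorem toTemperedDistribution_injective {f g : Lp C3 2 (volume : Measure R3)}
    (h : (f : 𝓢'(R3, C3)) = g) : f = g := by
  have hk := Lp.ker_toTemperedDistributionCLM_eq_bot (F := C3) (μ := (volume : Measure R3))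
    (p := 2)
  rw [LinearMap.ker_eq_bot] at hk
  exact hk h

/-- An `L²` class is determined by its distribution, so the infimum in `l2Norm` runs over at most
one element. -/
theorem l2Rep_spec {f : 𝓢'(R3, C3)} (hf : l2Norm f < ∞) :
    (l2Rep f : 𝓢'(R3, C3)) = f ∧ ‖l2Rep f‖ₑ = l2Norm f := by
  have hex : ∃ g : Lp C3 2 (volume : Measure R3), (g : 𝓢'(R3, C3)) = f := by
    by_contra hne
    push Not at hne
    refine hf.ne ?_
    rw [l2Norm]
    simp [hne]
  have h1 : (l2Rep f : 𝓢'(R3, C3)) = f := by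
    rw [l2Rep, dif_pos hex]; exact hex.choose_spec
  refine ⟨h1, le_antisymm ?_ ?_⟩
  · rw [l2Norm]
    refine le_iInf fun g => le_iInf fun hg => ?_
    rw [toTemperedDistribution_injective (hg.trans h1.symm)]
  · exact iInf₂_le (f := fun (g : Lp C3 2 (volume : Measure R3)) (_ : (g : 𝓢'(R3, C3)) = f) => ‖g‖ₑ)
      _ h1

theorem l2Rep_eq_or (f : 𝓢'(R3, C3)) : (l2Rep f : 𝓢'(R3, C3)) = f ∨ l2Rep f = 0 := by
  by_cases hex : ∃ g : Lp C3 2 (volume : Measure R3), (g : 𝓢'(R3, C3)) = f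
  · left; rw [l2Rep, dif_pos hex]; exact hex.choose_spec
  · right; rw [l2Rep, dif_neg hex]

/-- For `s` supported off the annulus, `𝓕 (𝓕 s)` is the reflection of `s`, which vanishes on the
symmetric annulus, so `Δ_j` kills `𝓕 s`. If `Δ_j f` has no `L²` representative, `l2Rep` is zero, so
no hypothesis on `f` is needed. -/
theorem fourier_l2Rep_delta_ae_zero (Φ : LPCutoff) (j : ℤ) (f : ZDual) :
    ∀ᵐ ξ, ξ ∈ (annulus j)ᶜ →
      (𝓕 (l2Rep (Φ.delta j f)) : Lp C3 2 (volume : Measure R3)) ξ = 0 := by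
  rcases l2Rep_eq_or (Φ.delta j f) with h | h
  · refine (isClosed_annulus j).isOpen_compl.ae_eq_zero_of_integral_contDiff_smul_eq_zero
      (((Lp.memLp (𝓕 (l2Rep (Φ.delta j f)))).locallyIntegrable
        (by norm_num)).locallyIntegrableOn _) ?_
    intro g g_smooth g_cpt g_supp
    have hg₁ : HasCompactSupport (Complex.ofRealCLM ∘ g) := g_cpt.comp_left rfl
    have hg₂ : ContDiff ℝ ((⊤ : ℕ∞) : WithTop ℕ∞) (Complex.ofRealCLM ∘ g) := by fun_prop
    set s : 𝓢(R3, ℂ) := hg₁.toSchwartzMap hg₂ with hs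
    have hsg : ∀ x (w : C3), g x • w = s x • w := fun x w => by simp [hs]
    simp_rw [hsg]
    rw [← Lp.toTemperedDistribution_apply, ← Lp.fourier_toTemperedDistribution_eq, h,
      TemperedDistribution.fourier_apply, Φ.delta_apply]
    have h0 : Φ.deltaZ j (𝓕 s) = 0 := by
      ext1
      change Φ.deltaS j (𝓕 s) = 0
      refine Φ.deltaS_eq_zero fun ξ hξ => ?_
      have e1 : (𝓕 (𝓕 s : 𝓢(R3, ℂ)) : 𝓢(R3, ℂ)) ξ = s (-ξ) := by
        have e2 : (𝓕⁻ (𝓕 s : 𝓢(R3, ℂ)) : 𝓢(R3, ℂ)) (-ξ) = s (-ξ) := by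
          rw [FourierTransform.fourierInv_fourier_eq]
        rw [← e2, SchwartzMap.fourierInv_coe, Real.fourierInv_eq_fourier_neg, neg_neg,
          SchwartzMap.fourier_coe]
      rw [e1]
      have : -ξ ∉ tsupport g := fun hmem => g_supp hmem (neg_mem_annulus.mpr hξ)
      simp [hs, image_eq_zero_of_notMem_tsupport this]
    rw [h0, map_zero]
  · rw [h, FourierTransform.fourier_zero]
    filter_upwards [Lp.coeFn_zero C3 2 (volume : Measure R3)] with ξ hξ _ using hξ

/-- The Fourier transform of the `i`-th component of the block `Δ_j f`. -/
def blockSpectrum (Φ : LPCutoff) (j : ℤ) (f : ZDual) (i : Fin 3) (ξ : R3) : ℂ :=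
  (annulus j).indicator
    ((𝓕 (l2Rep (Φ.delta j f)) : Lp C3 2 (volume : Measure R3)) : R3 → C3) ξ i

section blockSpectrum

variable (Φ : LPCutoff) (j : ℤ) (f : ZDual) (i : Fin 3)

theorem mem_annulus_of_blockSpectrum_ne_zero (ξ : R3) (h : blockSpectrum Φ j f i ξ ≠ 0) :
    ξ ∈ annulus j := by
  by_contra hξ
  exact h (by simp [blockSpectrum, Set.indicator_of_notMem hξ])

theorem memLp_indicator_fourier_l2Rep :
    MemLp ((annulus j).indicator
      ((𝓕 (l2Rep (Φ.delta j f)) : Lp C3 2 (volume : Measure R3)) : R3 → C3)) 2 volume :=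
  (Lp.memLp _).indicator (isClosed_annulus j).measurableSet

theorem memLp_blockSpectrum : MemLp (blockSpectrum Φ j f i) 2 volume :=
  (EuclideanSpace.proj i : C3 →L[ℂ] ℂ).comp_memLp' (memLp_indicator_fourier_l2Rep Φ j f)

theorem eLpNorm_blockSpectrum_le :
    eLpNorm (blockSpectrum Φ j f i) 2 volume ≤ ‖l2Rep (Φ.delta j f)‖ₑ := by
  calc eLpNorm (blockSpectrum Φ j f i) 2 volume
      ≤ eLpNorm ((annulus j).indicator
          ((𝓕 (l2Rep (Φ.delta j f)) : Lp C3 2 (volume : Measure R3)) : R3 → C3)) 2 volume :=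
        eLpNorm_mono fun ξ => PiLp.norm_apply_le _ i
    _ ≤ eLpNorm ((𝓕 (l2Rep (Φ.delta j f)) : Lp C3 2 (volume : Measure R3)) : R3 → C3) 2
          volume := eLpNorm_indicator_le _
    _ = ‖(𝓕 (l2Rep (Φ.delta j f)) : Lp C3 2 (volume : Measure R3))‖ₑ := (Lp.enorm_def _).symm
    _ = ‖l2Rep (Φ.delta j f)‖ₑ := by
        rw [← ofReal_norm, ← ofReal_norm, Lp.norm_fourier_eq]

/-- The indicator in `blockSpectrum` changes the spectrum only on a null set. It makes the support
condition hold at every point and the spectrum integrable, so that the block is given by a genuine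
Fourier integral. -/
theorem l2Rep_delta_apply_ae_eq :
    (fun x => (l2Rep (Φ.delta j f) : R3 → C3) x i) =ᵐ[volume] 𝓕⁻ (blockSpectrum Φ j f i) := by
  set G : R3 → C3 := (annulus j).indicator
    ((𝓕 (l2Rep (Φ.delta j f)) : Lp C3 2 (volume : Measure R3)) : R3 → C3) with hG
  have hG2 : MemLp G 2 volume := memLp_indicator_fourier_l2Rep Φ j f
  have hG1 : Integrable G := integrable_of_annulus (j := j) hG2 fun ξ h => by
    by_contra hξ
    exact h (by simp [hG, Set.indicator_of_notMem hξ])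
  have hGL : hG2.toLp G = 𝓕 (l2Rep (Φ.delta j f)) := by
    refine Lp.ext (hG2.coeFn_toLp.trans ?_)
    filter_upwards [fourier_l2Rep_delta_ae_zero Φ j f] with ξ hξ
    by_cases h : ξ ∈ annulus j
    · simp [hG, h]
    · simp [hG, h, hξ h]
  have h := fourierInv_toLp_ae_eq hG1 hG2
  rw [hGL, FourierTransform.fourierInv_fourier_eq] at h
  filter_upwards [h] with x hx
  rw [hx, Real.fourierInv_eq, Real.fourierInv_eq]
  have hint : Integrable (fun v => Real.fourierChar (inner ℝ v x) • G v) := by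
    have := (Real.fourierIntegral_convergent_iff (μ := volume) (f := G) (-x)).2 hG1
    simpa using this
  have := (EuclideanSpace.proj i : C3 →L[ℂ] ℂ).integral_comp_comm hint
  simpa [blockSpectrum, hG, Circle.smul_def] using this.symm

end blockSpectrum

/-! ### The Stokes-Coriolis multiplier -/

theorem abs_apply_div_norm_le_one (ξ : R3) (i : Fin 3) : |ξ i / ‖ξ‖| ≤ 1 := by
  rw [abs_div, abs_of_nonneg (norm_nonneg ξ)]
  exact div_le_one_of_le₀ (PiLp.norm_apply_le ξ i) (norm_nonneg ξ)

theorem abs_rotMatrix_le_one (ξ : R3) (i j : Fin 3) : |rotMatrix ξ i j| ≤ 1 := by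
  have h := abs_apply_div_norm_le_one ξ
  fin_cases i <;> fin_cases j <;> simp [rotMatrix] <;> exact h _

theorem abs_helmholtzSymbol_le_two (ξ : R3) (i j : Fin 3) : |helmholtzSymbol ξ i j| ≤ 2 := by
  have h1 : |(1 : Matrix (Fin 3) (Fin 3) ℝ) i j| ≤ 1 := by
    rw [Matrix.one_apply]; split_ifs <;> simp
  have h2 : |(‖ξ‖ ^ 2)⁻¹ * (ξ i * ξ j)| ≤ 1 := by
    have e : (‖ξ‖ ^ 2)⁻¹ * (ξ i * ξ j) = (ξ i / ‖ξ‖) * (ξ j / ‖ξ‖) := by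
      rw [div_mul_div_comm, ← sq, inv_mul_eq_div]
    rw [e, abs_mul]
    exact mul_le_one₀ (abs_apply_div_norm_le_one ξ i) (abs_nonneg _)
      (abs_apply_div_norm_le_one ξ j)
  have e : helmholtzSymbol ξ i j
      = (1 : Matrix (Fin 3) (Fin 3) ℝ) i j - (‖ξ‖ ^ 2)⁻¹ * (ξ i * ξ j) := by
    simp [helmholtzSymbol, Matrix.vecMulVec_apply]
  rw [e]
  linarith [abs_sub ((1 : Matrix (Fin 3) (Fin 3) ℝ) i j) ((‖ξ‖ ^ 2)⁻¹ * (ξ i * ξ j))]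

/-- The rotation contributes only a cosine and a sine, each at most one in modulus. This is why no
constant depends on `Ω`. -/
theorem abs_semigroupSymbol_le (ν Ω t : ℝ) (ξ : R3) (i j : Fin 3) :
    |semigroupSymbol ν Ω t ξ i j| ≤ 2 * Real.exp (-ν * ‖ξ‖ ^ 2 * t) := by
  have h1 : |(1 : Matrix (Fin 3) (Fin 3) ℝ) i j| ≤ 1 := by
    rw [Matrix.one_apply]; split_ifs <;> simp
  have e : semigroupSymbol ν Ω t ξ i j = Real.exp (-ν * ‖ξ‖ ^ 2 * t) *
      (Real.cos (Ω * (ξ 2 / ‖ξ‖) * t) * (1 : Matrix (Fin 3) (Fin 3) ℝ) i j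
        + Real.sin (Ω * (ξ 2 / ‖ξ‖) * t) * rotMatrix ξ i j) := by
    simp [semigroupSymbol]
  rw [e, abs_mul, abs_of_pos (Real.exp_pos _), mul_comm]
  refine mul_le_mul_of_nonneg_right ((abs_add_le _ _).trans ?_) (Real.exp_pos _).le
  rw [abs_mul, abs_mul]
  have := mul_le_one₀ (Real.abs_cos_le_one (Ω * (ξ 2 / ‖ξ‖) * t)) (abs_nonneg _) h1
  have := mul_le_one₀ (Real.abs_sin_le_one (Ω * (ξ 2 / ‖ξ‖) * t)) (abs_nonneg _)
    (abs_rotMatrix_le_one ξ i j)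
  linarith

theorem norm_duhamelSymbol_le (ν Ω t : ℝ) (i l k : Fin 3) (ξ : R3) :
    ‖duhamelSymbol ν Ω t i l k ξ‖ ≤ 12 * Real.exp (-ν * ‖ξ‖ ^ 2 * t) * |ξ l| := by
  rw [duhamelSymbol, norm_mul, norm_mul, Complex.norm_I, one_mul, Complex.norm_real,
    Complex.norm_real, Real.norm_eq_abs, Real.norm_eq_abs]
  refine mul_le_mul_of_nonneg_right ?_ (abs_nonneg _)
  rw [Matrix.mul_apply]
  refine (Finset.abs_sum_le_sum_abs _ _).trans ?_
  -- Each of the three terms of the matrix product is at most `2 · 2` times the exponential, whence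
  -- the constant `12`.
  have h : ∀ m ∈ (Finset.univ : Finset (Fin 3)),
      |semigroupSymbol ν Ω t ξ i m * helmholtzSymbol ξ m k|
        ≤ 4 * Real.exp (-ν * ‖ξ‖ ^ 2 * t) := fun m _ => by
    rw [abs_mul]
    have := mul_le_mul (abs_semigroupSymbol_le ν Ω t ξ i m) (abs_helmholtzSymbol_le_two ξ m k)
      (abs_nonneg _) (by positivity)
    linarith
  refine (Finset.sum_le_sum h).trans (le_of_eq ?_)
  simp
  ring

theorem measurable_rotMatrix_apply (i j : Fin 3) : Measurable fun ξ : R3 => rotMatrix ξ i j := by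
  fin_cases i <;> fin_cases j <;> simp [rotMatrix] <;> fun_prop

theorem measurable_duhamelSymbol (ν Ω t : ℝ) (i l k : Fin 3) :
    Measurable (duhamelSymbol ν Ω t i l k) := by
  have h1 : ∀ a b, Measurable fun ξ : R3 => semigroupSymbol ν Ω t ξ a b := fun a b => by
    have := measurable_rotMatrix_apply a b
    simp only [semigroupSymbol, Matrix.smul_apply, Matrix.add_apply, smul_eq_mul]
    fun_prop
  have h2 : ∀ a b, Measurable fun ξ : R3 => helmholtzSymbol ξ a b := fun a b => by
    simp only [helmholtzSymbol, Matrix.sub_apply, Matrix.smul_apply, Matrix.vecMulVec_apply,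
      smul_eq_mul]
    fun_prop
  unfold duhamelSymbol
  simp only [Matrix.mul_apply]
  fun_prop

theorem continuous_duhamelSymbol_time (ν Ω : ℝ) (i l k : Fin 3) (ξ : R3) :
    Continuous fun t => duhamelSymbol ν Ω t i l k ξ := by
  have h1 : ∀ a b, Continuous fun t => semigroupSymbol ν Ω t ξ a b := fun a b => by
    simp only [semigroupSymbol, Matrix.smul_apply, Matrix.add_apply, smul_eq_mul]
    fun_prop
  unfold duhamelSymbol
  simp only [Matrix.mul_apply]
  fun_prop

/-- The Fourier transform of the transposed Duhamel multiplier applied to `ψ`. -/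
def duhamelSpectrum (ν Ω s : ℝ) (i l k : Fin 3) (ψ : 𝓢(R3, ℂ)) (ξ : R3) : ℂ :=
  duhamelSymbol ν Ω s i l k (-((2 * Real.pi) • ξ)) * (𝓕 ψ : 𝓢(R3, ℂ)) ξ

theorem transposedMultiplier_eq (ν Ω s : ℝ) (i l k : Fin 3) (ψ : 𝓢(R3, ℂ)) :
    transposedMultiplier (duhamelSymbol ν Ω s i l k) ψ = 𝓕⁻ (duhamelSpectrum ν Ω s i l k ψ) :=
  rfl

theorem duhamelSpectrum_add (ν Ω s : ℝ) (i l k : Fin 3) (ψ χ : 𝓢(R3, ℂ)) :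
    duhamelSpectrum ν Ω s i l k (ψ + χ)
      = duhamelSpectrum ν Ω s i l k ψ + duhamelSpectrum ν Ω s i l k χ := by
  ext ξ
  simp [duhamelSpectrum, FourierTransform.fourier_add, mul_add]

theorem duhamelSpectrum_smul (ν Ω s : ℝ) (i l k : Fin 3) (a : ℂ) (ψ : 𝓢(R3, ℂ)) :
    duhamelSpectrum ν Ω s i l k (a • ψ) = a • duhamelSpectrum ν Ω s i l k ψ := by
  ext ξ
  simp [duhamelSpectrum, FourierTransform.fourier_smul, mul_left_comm]

/-- The Schwartz function `2π ξ_l 𝓕ψ`. -/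
def freqMul (l : Fin 3) : 𝓢(R3, ℂ) →L[ℂ] 𝓢(R3, ℂ) :=
  (SchwartzMap.smulLeftCLM ℂ (fun ξ : R3 => (((2 * Real.pi) * ξ l : ℝ) : ℂ))).comp
    (FourierTransform.fourierCLM ℂ 𝓢(R3, ℂ))

theorem freqMul_apply (l : Fin 3) (ψ : 𝓢(R3, ℂ)) (ξ : R3) :
    freqMul l ψ ξ = (((2 * Real.pi) * ξ l : ℝ) : ℂ) * (𝓕 ψ : 𝓢(R3, ℂ)) ξ := by
  have h : (fun ξ : R3 => (((2 * Real.pi) * ξ l : ℝ) : ℂ)).HasTemperateGrowth := by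
    have h1 : (fun ξ : R3 => ((2 * Real.pi) * ξ l : ℝ)).HasTemperateGrowth := by
      exact ((2 * Real.pi) • (EuclideanSpace.proj l : R3 →L[ℝ] ℝ)).hasTemperateGrowth
    exact (Complex.ofRealCLM.hasTemperateGrowth).comp h1
  rw [freqMul, ContinuousLinearMap.comp_apply, SchwartzMap.smulLeftCLM_apply_apply h]
  rfl

section bounds

variable {ν : ℝ} (Ω : ℝ) {s : ℝ} (i l k : Fin 3) (ψ : 𝓢(R3, ℂ))

theorem norm_duhamelSpectrum_le_exp (ξ : R3) :
    ‖duhamelSpectrum ν Ω s i l k ψ ξ‖ ≤ 12 * Real.exp (-ν * ‖(2 * Real.pi) • ξ‖ ^ 2 * s) *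
      (‖(2 * Real.pi) • ξ‖ * ‖(𝓕 ψ : 𝓢(R3, ℂ)) ξ‖) := by
  rw [duhamelSpectrum, norm_mul, ← mul_assoc]
  refine mul_le_mul_of_nonneg_right ?_ (norm_nonneg _)
  refine (norm_duhamelSymbol_le ν Ω s i l k _).trans ?_
  rw [norm_neg]
  refine mul_le_mul_of_nonneg_left ?_ (by positivity)
  have := PiLp.norm_apply_le (-((2 * Real.pi) • ξ)) l
  rwa [norm_neg] at this

/-- Discarding the heat factor leaves a Schwartz majorant independent of `s` and `Ω` and continuous
in `ψ`. It serves as the dominating function in time and as the source of continuity on `𝒵`. -/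
theorem norm_duhamelSpectrum_le (hν : 0 ≤ ν) (hs : 0 ≤ s) (ξ : R3) :
    ‖duhamelSpectrum ν Ω s i l k ψ ξ‖ ≤ 12 * ‖freqMul l ψ ξ‖ := by
  rw [duhamelSpectrum, norm_mul, freqMul_apply, norm_mul, ← mul_assoc]
  refine mul_le_mul_of_nonneg_right ?_ (norm_nonneg _)
  refine (norm_duhamelSymbol_le ν Ω s i l k _).trans ?_
  have h1 : Real.exp (-ν * ‖-((2 * Real.pi) • ξ)‖ ^ 2 * s) ≤ 1 := by
    rw [Real.exp_le_one_iff]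
    have : 0 ≤ ν * ‖-((2 * Real.pi) • ξ)‖ ^ 2 * s := by positivity
    linarith
  have h2 : |(-((2 * Real.pi) • ξ)) l| = ‖(((2 * Real.pi) * ξ l : ℝ) : ℂ)‖ := by
    rw [Complex.norm_real, Real.norm_eq_abs]
    simp [abs_mul]
  rw [h2]
  refine mul_le_mul_of_nonneg_right ?_ (norm_nonneg _)
  linarith

theorem aestronglyMeasurable_duhamelSpectrum (ν s : ℝ) :
    AEStronglyMeasurable (duhamelSpectrum ν Ω s i l k ψ) volume := by
  refine Measurable.aestronglyMeasurable ?_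
  refine ((measurable_duhamelSymbol ν Ω s i l k).comp (by fun_prop)).mul ?_
  exact (SchwartzMap.continuous _).measurable

theorem eLpNorm_duhamelSpectrum_le (hν : 0 ≤ ν) (hs : 0 ≤ s) (p : ℝ≥0∞) :
    eLpNorm (duhamelSpectrum ν Ω s i l k ψ) p volume
      ≤ 12 * eLpNorm (freqMul l ψ) p volume := by
  have := eLpNorm_le_mul_eLpNorm_of_ae_le_mul (μ := (volume : Measure R3)) (p := p)
    (Filter.Eventually.of_forall (norm_duhamelSpectrum_le Ω i l k ψ hν hs))
  simpa using this

theorem memLp_duhamelSpectrum (hν : 0 ≤ ν) (hs : 0 ≤ s) (p : ℝ≥0∞) :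
    MemLp (duhamelSpectrum ν Ω s i l k ψ) p volume :=
  ⟨aestronglyMeasurable_duhamelSpectrum Ω i l k ψ ν s,
    (eLpNorm_duhamelSpectrum_le Ω i l k ψ hν hs p).trans_lt
      (ENNReal.mul_lt_top (by simp) ((freqMul l ψ).memLp p volume).2)⟩

theorem integrable_duhamelSpectrum (hν : 0 ≤ ν) (hs : 0 ≤ s) :
    Integrable (duhamelSpectrum ν Ω s i l k ψ) :=
  memLp_one_iff_integrable.mp (memLp_duhamelSpectrum Ω i l k ψ hν hs 1)

end bounds

theorem LPCutoff.exists_bound (Φ : LPCutoff) : ∃ M : ℝ, 0 ≤ M ∧ ∀ j ξ, ‖Φ.symbol j ξ‖ ≤ M :=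
  ⟨‖Φ.φ.toBoundedContinuousFunction‖, norm_nonneg _, fun _ _ =>
    Φ.φ.toBoundedContinuousFunction.norm_coe_le_norm _⟩

theorem duhamelSpectrum_deltaS_mem_annulus (Φ : LPCutoff) (ν Ω s : ℝ) (i l k : Fin 3) (j : ℤ)
    (ψ : 𝓢(R3, ℂ)) (ξ : R3) (h : duhamelSpectrum ν Ω s i l k (Φ.deltaS j ψ) ξ ≠ 0) :
    ξ ∈ annulus j := by
  refine Φ.mem_annulus_of_symbol_ne_zero fun h0 => h ?_
  simp [duhamelSpectrum, Φ.fourier_deltaS_apply, h0]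

theorem eLpNorm_fourier_schwartz (ψ : 𝓢(R3, ℂ)) :
    eLpNorm (𝓕 ψ : 𝓢(R3, ℂ)) 2 volume = eLpNorm ψ 2 volume := by
  have h := SchwartzMap.norm_fourier_toL2_eq ψ
  have h2 : ‖(𝓕 ψ : 𝓢(R3, ℂ)).toLp 2‖ₑ = ‖ψ.toLp 2‖ₑ := by
    rw [← ofReal_norm, ← ofReal_norm, h]
  rwa [Lp.enorm_def, Lp.enorm_def, eLpNorm_congr_ae (SchwartzMap.coeFn_toLp _ _ _),
    eLpNorm_congr_ae (SchwartzMap.coeFn_toLp _ _ _)] at h2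

/-- The outer radius of the annulus bounds the derivative, `32 = 12 · 8/3`; the inner radius bounds
the heat factor, `9/16 = (3/4)²`. -/
theorem eLpNorm_duhamelSpectrum_deltaS_le {Φ : LPCutoff} {M : ℝ} (hM0 : 0 ≤ M)
    (hM : ∀ j ξ, ‖Φ.symbol j ξ‖ ≤ M) {ν : ℝ} (hν : 0 ≤ ν) (Ω : ℝ) {s : ℝ} (hs : 0 ≤ s)
    (i l k : Fin 3) (j : ℤ) (ψ : 𝓢(R3, ℂ)) :
    eLpNorm (duhamelSpectrum ν Ω s i l k (Φ.deltaS j ψ)) 2 volume ≤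
      ENNReal.ofReal (32 * M * (2 : ℝ) ^ j * Real.exp (-(9 / 16 * ν * (2 : ℝ) ^ (2 * j) * s))) *
        eLpNorm ψ 2 volume := by
  rw [← eLpNorm_fourier_schwartz ψ]
  refine eLpNorm_le_mul_eLpNorm_of_ae_le_mul (Filter.Eventually.of_forall fun ξ => ?_) 2
  by_cases h : duhamelSpectrum ν Ω s i l k (Φ.deltaS j ψ) ξ = 0
  · rw [h, norm_zero]; positivity
  obtain ⟨h1, h2⟩ := duhamelSpectrum_deltaS_mem_annulus Φ ν Ω s i l k j ψ ξ h
  refine (norm_duhamelSpectrum_le_exp Ω i l k _ ξ).trans ?_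
  rw [Φ.fourier_deltaS_apply, norm_mul]
  have h3 : Real.exp (-ν * ‖(2 * Real.pi) • ξ‖ ^ 2 * s)
      ≤ Real.exp (-(9 / 16 * ν * (2 : ℝ) ^ (2 * j) * s)) := by
    refine Real.exp_le_exp.mpr ?_
    have e : (2 : ℝ) ^ (2 * j) = ((2 : ℝ) ^ j) ^ 2 := by rw [mul_comm, zpow_mul]; norm_cast
    have h4 : (3 / 4 * (2 : ℝ) ^ j) ^ 2 ≤ ‖(2 * Real.pi) • ξ‖ ^ 2 :=
      pow_le_pow_left₀ (by positivity) h1 2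
    have h5 := mul_le_mul_of_nonneg_left h4 (mul_nonneg hν hs)
    rw [e]
    nlinarith
  calc 12 * Real.exp (-ν * ‖(2 * Real.pi) • ξ‖ ^ 2 * s) *
        (‖(2 * Real.pi) • ξ‖ * (‖Φ.symbol j ξ‖ * ‖(𝓕 ψ : 𝓢(R3, ℂ)) ξ‖))
      ≤ 12 * Real.exp (-(9 / 16 * ν * (2 : ℝ) ^ (2 * j) * s)) *
        (8 / 3 * (2 : ℝ) ^ j * (M * ‖(𝓕 ψ : 𝓢(R3, ℂ)) ξ‖)) := by
        gcongr
        exact hM j ξ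
    _ = _ := by ring

/-! ### Absolutely convergent series of functions and dyadic sums -/

section Series

variable {α ι : Type*} [MeasurableSpace α] {μ : Measure α} [Countable ι]
  {f : ι → α → ℂ} {c : ι → ℝ}

theorem lintegral_tsum_enorm_lt_top (hm : ∀ i, AEStronglyMeasurable (f i) μ)
    (hc0 : ∀ i, 0 ≤ c i) (hc : Summable c)
    (h : ∀ i, eLpNorm (f i) 1 μ ≤ ENNReal.ofReal (c i)) :
    ∫⁻ x, ∑' i, ‖f i x‖ₑ ∂μ < ∞ := by
  rw [lintegral_tsum fun i => (hm i).enorm]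
  calc ∑' i, ∫⁻ x, ‖f i x‖ₑ ∂μ ≤ ∑' i, ENNReal.ofReal (c i) :=
        ENNReal.tsum_le_tsum fun i => by rw [← eLpNorm_one_eq_lintegral_enorm]; exact h i
    _ = ENNReal.ofReal (∑' i, c i) := (ENNReal.ofReal_tsum_of_nonneg hc0 hc).symm
    _ < ∞ := ENNReal.ofReal_lt_top

theorem ae_summable_norm_of_eLpNorm (hm : ∀ i, AEStronglyMeasurable (f i) μ)
    (hc0 : ∀ i, 0 ≤ c i) (hc : Summable c)
    (h : ∀ i, eLpNorm (f i) 1 μ ≤ ENNReal.ofReal (c i)) :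
    ∀ᵐ x ∂μ, Summable fun i => ‖f i x‖ := by
  have hlt := lintegral_tsum_enorm_lt_top hm hc0 hc h
  filter_upwards [ae_lt_top' (AEMeasurable.tsum fun i => (hm i).enorm) hlt.ne] with x hx
  have h1 : Summable fun i => ‖f i x‖₊ := ENNReal.tsum_coe_ne_top_iff_summable.mp hx.ne
  exact NNReal.summable_coe.mpr h1

theorem integrable_tsum_of_eLpNorm (hm : ∀ i, AEStronglyMeasurable (f i) μ)
    (hc0 : ∀ i, 0 ≤ c i) (hc : Summable c)
    (h : ∀ i, eLpNorm (f i) 1 μ ≤ ENNReal.ofReal (c i)) :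
    Integrable (fun x => ∑' i, f i x) μ := by
  refine ⟨?_, ?_⟩
  · refine aestronglyMeasurable_of_tendsto_ae (Filter.atTop : Filter (Finset ι))
      (f := fun s x => ∑ i ∈ s, f i x) (fun s => ?_) ?_
    · exact Finset.aestronglyMeasurable_fun_sum s fun i _ => hm i
    · filter_upwards [ae_summable_norm_of_eLpNorm hm hc0 hc h] with x hx
      exact hx.of_norm.hasSum
  · refine lt_of_le_of_lt (lintegral_mono fun x => ?_) (lintegral_tsum_enorm_lt_top hm hc0 hc h)
    exact enorm_tsum_le_tsum_enorm

theorem hasSum_integral_of_eLpNorm (hm : ∀ i, AEStronglyMeasurable (f i) μ)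
    (hc0 : ∀ i, 0 ≤ c i) (hc : Summable c)
    (h : ∀ i, eLpNorm (f i) 1 μ ≤ ENNReal.ofReal (c i)) :
    HasSum (fun i => ∫ x, f i x ∂μ) (∫ x, ∑' i, f i x ∂μ) := by
  have hi : ∀ i, Integrable (f i) μ := fun i =>
    memLp_one_iff_integrable.mp ⟨hm i, (h i).trans_lt ENNReal.ofReal_lt_top⟩
  refine hasSum_integral_of_summable_integral_norm hi (hc.of_nonneg_of_le (fun i => ?_) fun i => ?_)
  · exact integral_nonneg fun x => norm_nonneg _
  · rw [← ENNReal.ofReal_le_ofReal_iff (hc0 i), ofReal_integral_norm_eq_lintegral_enorm (hi i),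
      ← eLpNorm_one_eq_lintegral_enorm]
    exact h i

end Series

/-- A two-sided geometric weight centred at `n`. -/
def dyadicDecay (n k : ℤ) : ℝ := (2 : ℝ) ^ (-|(k : ℝ) - n| / 4)

theorem dyadicDecay_pos (n k : ℤ) : 0 < dyadicDecay n k := by unfold dyadicDecay; positivity

theorem summable_dyadicDecay_zero : Summable (dyadicDecay 0) := by
  have hr0 : (0 : ℝ) ≤ (2 : ℝ) ^ (-(1 / 4) : ℝ) := by positivity
  have hr1 : (2 : ℝ) ^ (-(1 / 4) : ℝ) < 1 :=
    Real.rpow_lt_one_of_one_lt_of_neg (by norm_num) (by norm_num)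
  have hg := summable_geometric_of_lt_one hr0 hr1
  refine Summable.of_nat_of_neg (hg.congr fun n => ?_) (hg.congr fun n => ?_)
  all_goals
    rw [dyadicDecay, ← Real.rpow_natCast, ← Real.rpow_mul (by norm_num)]
    congr 1
    push_cast
    simp
    ring

theorem dyadicDecay_eq (n k : ℤ) : dyadicDecay n k = dyadicDecay 0 (k - n) := by
  simp [dyadicDecay]

theorem summable_dyadicDecay (n : ℤ) : Summable (dyadicDecay n) := by
  have := (Equiv.subRight n).summable_iff.mpr summable_dyadicDecay_zero
  exact this.congr fun k => (dyadicDecay_eq n k).symm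

/-- The sum of the two-sided geometric weights. -/
def dyadicSum : ℝ := ∑' k, dyadicDecay 0 k

theorem dyadicSum_nonneg : 0 ≤ dyadicSum := tsum_nonneg fun k => (dyadicDecay_pos 0 k).le

theorem tsum_dyadicDecay (n : ℤ) : ∑' k, dyadicDecay n k = dyadicSum := by
  rw [dyadicSum, ← (Equiv.subRight n).tsum_eq (dyadicDecay 0)]
  exact tsum_congr fun k => dyadicDecay_eq n k

theorem hasSum_dyadicDecay_mul (n : ℤ) (M : ℝ) :
    HasSum (fun p : ℤ × ℤ => M * (dyadicDecay n p.1 * dyadicDecay n p.2))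
      (M * dyadicSum ^ 2) := by
  have hs := summable_dyadicDecay n
  have h := (hs.hasSum.mul hs.hasSum (hs.mul_of_nonneg hs (fun k => (dyadicDecay_pos n k).le)
    fun k => (dyadicDecay_pos n k).le)).mul_left M
  rwa [tsum_dyadicDecay, ← sq] at h

/-- The exponent bookkeeping for one term of the double dyadic sum. -/
theorem dyadic_term_le {t m₁ m₂ A B a b : ℝ} {k l n : ℤ} (hm₁ : 0 ≤ m₁) (hm₂ : 0 ≤ m₂)
    (hA : 0 ≤ A) (hB : 0 ≤ B)  (hb0 : 0 ≤ b)
    (h1 : t ≤ m₁ * (a * b)) (h2 : t ≤ m₂ * (2 : ℝ) ^ (3 / 2 * (k : ℝ)) * (a * b))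
    (h3 : t ≤ m₂ * (2 : ℝ) ^ (3 / 2 * (l : ℝ)) * (a * b))
    (ha : a ≤ A * (2 : ℝ) ^ (-(k : ℝ) / 2))
    (hb : b ≤ B * (2 : ℝ) ^ (-(l : ℝ) / 2 + max ((n : ℝ) - l) 0 / 2))
    (hlow : k < n → l < n → t ≤ 0 ∨ b ≤ B * (2 : ℝ) ^ (-(l : ℝ) / 2)) :
    t ≤ (m₁ * (2 : ℝ) ^ (-(n : ℝ)) + m₂ * (2 : ℝ) ^ ((n : ℝ) / 2)) * A * B *
      (dyadicDecay n k * dyadicDecay n l) := by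
  have hdd : dyadicDecay n k * dyadicDecay n l
      = (2 : ℝ) ^ (-|(k : ℝ) - n| / 4 + -|(l : ℝ) - n| / 4) := by
    rw [dyadicDecay, dyadicDecay, ← Real.rpow_add (by norm_num)]
  have hR0 : 0 ≤ (m₁ * (2 : ℝ) ^ (-(n : ℝ)) + m₂ * (2 : ℝ) ^ ((n : ℝ) / 2)) * A * B *
      (dyadicDecay n k * dyadicDecay n l) := by
    have := dyadicDecay_pos n k
    have := dyadicDecay_pos n l
    positivity
  have hab : ∀ β : ℝ, b ≤ B * (2 : ℝ) ^ β →
      a * b ≤ A * B * (2 : ℝ) ^ (-(k : ℝ) / 2 + β) := fun β hβ => by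
    refine (mul_le_mul ha hβ hb0 (by positivity)).trans (le_of_eq ?_)
    rw [Real.rpow_add (by norm_num)]; ring
  have high : ∀ β : ℝ, b ≤ B * (2 : ℝ) ^ β →
      -(k : ℝ) / 2 + β ≤ -(n : ℝ) + (-|(k : ℝ) - n| / 4 + -|(l : ℝ) - n| / 4) →
      t ≤ (m₁ * (2 : ℝ) ^ (-(n : ℝ)) + m₂ * (2 : ℝ) ^ ((n : ℝ) / 2)) * A * B *
        (dyadicDecay n k * dyadicDecay n l) := fun β hβ he => by
    calc t ≤ m₁ * (a * b) := h1
      _ ≤ m₁ * (A * B * (2 : ℝ) ^ (-(n : ℝ) + (-|(k : ℝ) - n| / 4 + -|(l : ℝ) - n| / 4))) := by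
          refine mul_le_mul_of_nonneg_left ((hab β hβ).trans ?_) hm₁
          refine mul_le_mul_of_nonneg_left ?_ (by positivity)
          exact Real.rpow_le_rpow_of_exponent_le (by norm_num) he
      _ = m₁ * (2 : ℝ) ^ (-(n : ℝ)) * A * B * (dyadicDecay n k * dyadicDecay n l) := by
          rw [hdd, Real.rpow_add (by norm_num)]; ring
      _ ≤ _ := by
          have := dyadicDecay_pos n k
          have := dyadicDecay_pos n l
          gcongr
          exact le_add_of_nonneg_right (by positivity)
  have low : ∀ β γ : ℝ, t ≤ m₂ * (2 : ℝ) ^ γ * (a * b) → b ≤ B * (2 : ℝ) ^ β →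
      γ + (-(k : ℝ) / 2 + β) ≤ (n : ℝ) / 2 + (-|(k : ℝ) - n| / 4 + -|(l : ℝ) - n| / 4) →
      t ≤ (m₁ * (2 : ℝ) ^ (-(n : ℝ)) + m₂ * (2 : ℝ) ^ ((n : ℝ) / 2)) * A * B *
        (dyadicDecay n k * dyadicDecay n l) := fun β γ ht hβ he => by
    calc t ≤ m₂ * (2 : ℝ) ^ γ * (a * b) := ht
      _ ≤ m₂ * (2 : ℝ) ^ γ * (A * B * (2 : ℝ) ^ (-(k : ℝ) / 2 + β)) :=
          mul_le_mul_of_nonneg_left (hab β hβ) (by positivity)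
      _ = m₂ * (A * B * (2 : ℝ) ^ (γ + (-(k : ℝ) / 2 + β))) := by
          rw [Real.rpow_add (x := 2) (by norm_num) γ]; ring
      _ ≤ m₂ * (A * B * (2 : ℝ) ^ ((n : ℝ) / 2 + (-|(k : ℝ) - n| / 4 + -|(l : ℝ) - n| / 4))) := by
          refine mul_le_mul_of_nonneg_left ?_ hm₂
          refine mul_le_mul_of_nonneg_left ?_ (by positivity)
          exact Real.rpow_le_rpow_of_exponent_le (by norm_num) he
      _ = m₂ * (2 : ℝ) ^ ((n : ℝ) / 2) * A * B * (dyadicDecay n k * dyadicDecay n l) := by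
          rw [hdd, Real.rpow_add (x := 2) (by norm_num) ((n : ℝ) / 2)]; ring
      _ ≤ _ := by
          have := dyadicDecay_pos n k
          have := dyadicDecay_pos n l
          gcongr
          exact le_add_of_nonneg_left (by positivity)
  -- If both indices are at least `n`, the test function is taken in `L^∞` (`h1`). Otherwise the
  -- factor of lower frequency is, at the Bernstein cost `2^{3k/2}` or `2^{3l/2}`. For `l < n ≤ k`
  -- the extra growth `2^{(n-l)/2}` still leaves the exponent `n/2 + (l-n)/2 - (k-n)/2`. For `k, l <
  -- n` it would destroy all decay on the diagonal `k = l`; this is why `hlow` asks there for a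
  -- vanishing term or for a bound without growth.
  rcases lt_or_ge k n with hk | hk <;> rcases lt_or_ge l n with hl | hl
  · have hk' : (k : ℝ) < n := by exact_mod_cast hk
    have hl' : (l : ℝ) < n := by exact_mod_cast hl
    rcases hlow hk hl with h0 | hb'
    · exact h0.trans hR0
    · rw [abs_of_neg (sub_neg.mpr hk'), abs_of_neg (sub_neg.mpr hl')] at low
      rcases le_total k l with hkl | hkl
      · have : (k : ℝ) ≤ l := by exact_mod_cast hkl
        exact low _ _ h2 hb' (by linarith)
      · have : (l : ℝ) ≤ k := by exact_mod_cast hkl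
        exact low _ _ h3 hb' (by linarith)
  · have hk' : (k : ℝ) < n := by exact_mod_cast hk
    have hl' : (n : ℝ) ≤ l := by exact_mod_cast hl
    rw [max_eq_right (by linarith)] at hb
    rw [abs_of_neg (sub_neg.mpr hk'), abs_of_nonneg (sub_nonneg.mpr hl')] at low
    exact low _ _ h2 hb (by linarith)
  · have hk' : (n : ℝ) ≤ k := by exact_mod_cast hk
    have hl' : (l : ℝ) < n := by exact_mod_cast hl
    rw [max_eq_left (by linarith)] at hb
    rw [abs_of_nonneg (sub_nonneg.mpr hk'), abs_of_neg (sub_neg.mpr hl')] at low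
    exact low _ _ h3 hb (by linarith)
  · have hk' : (n : ℝ) ≤ k := by exact_mod_cast hk
    have hl' : (n : ℝ) ≤ l := by exact_mod_cast hl
    rw [max_eq_right (by linarith)] at hb
    rw [abs_of_nonneg (sub_nonneg.mpr hk'), abs_of_nonneg (sub_nonneg.mpr hl')] at high
    exact high _ hb (by linarith)

/-! ### Trilinear estimates for dyadic families -/

/-- Spectra `F k` in the dyadic annuli with `L²` norms at most `a k`. -/
structure IsDyadicFamily (F : ℤ → R3 → ℂ) (a : ℤ → ℝ) : Prop where
  memLp : ∀ k, MemLp (F k) 2 volume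
  support : ∀ k ξ, F k ξ ≠ 0 → ξ ∈ annulus k
  nonneg : ∀ k, 0 ≤ a k
  bound : ∀ k, eLpNorm (F k) 2 volume ≤ ENNReal.ofReal (a k)

namespace IsDyadicFamily

variable {F G : ℤ → R3 → ℂ} {a b : ℤ → ℝ}

theorem integrable (hF : IsDyadicFamily F a) (k : ℤ) : Integrable (F k) :=
  integrable_of_annulus (hF.memLp k) (hF.support k)

theorem aestronglyMeasurable (hF : IsDyadicFamily F a) (k : ℤ) :
    AEStronglyMeasurable (𝓕⁻ (F k) : R3 → ℂ) volume :=
  (continuous_fourierInv_of_integrable (hF.integrable k)).aestronglyMeasurable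

theorem eLpNorm_two_le (hF : IsDyadicFamily F a) (k : ℤ) :
    eLpNorm (𝓕⁻ (F k) : R3 → ℂ) 2 volume ≤ ENNReal.ofReal (a k) := by
  rw [eLpNorm_two_fourierInv (hF.integrable k) (hF.memLp k)]
  exact hF.bound k

theorem eLpNorm_top_le (hF : IsDyadicFamily F a) (k : ℤ) :
    eLpNorm (𝓕⁻ (F k) : R3 → ℂ) ∞ volume ≤
      ENNReal.ofReal (a k * (bernsteinConst * (2 : ℝ) ^ (3 / 2 * (k : ℝ)))) := by
  refine (eLpNorm_top_fourierInv_le _ (hF.integrable k)).trans ?_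
  refine (eLpNorm_one_le_of_annulus (hF.memLp k).1 (hF.support k)).trans ?_
  rw [ENNReal.ofReal_mul (hF.nonneg k)]
  exact mul_le_mul_left (hF.bound k) _

/-- One term of the trilinear form. -/
def term (X : R3 → ℂ) (F G : ℤ → R3 → ℂ) (p : ℤ × ℤ) (x : R3) : ℂ :=
  𝓕⁻ X x * (𝓕⁻ (F p.1) x * 𝓕⁻ (G p.2) x)

theorem aestronglyMeasurable_term (hF : IsDyadicFamily F a) (hG : IsDyadicFamily G b)
    {X : R3 → ℂ} (hX : Integrable X) (p : ℤ × ℤ) :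
    AEStronglyMeasurable (term X F G p) volume :=
  (continuous_fourierInv_of_integrable hX).aestronglyMeasurable.mul
    ((hF.aestronglyMeasurable p.1).mul (hG.aestronglyMeasurable p.2))

theorem eLpNorm_mul_le {f g : R3 → ℂ} (hf : AEStronglyMeasurable f volume)
    (hg : AEStronglyMeasurable g volume) (p q r : ℝ≥0∞) [ENNReal.HolderTriple p q r] {s t : ℝ}
    (hs : 0 ≤ s) (h1 : eLpNorm f p volume ≤ ENNReal.ofReal s)
    (h2 : eLpNorm g q volume ≤ ENNReal.ofReal t) :
    eLpNorm (fun x => f x * g x) r volume ≤ ENNReal.ofReal (s * t) := by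
  rw [ENNReal.ofReal_mul hs]
  exact (eLpNorm_smul_le_mul_eLpNorm hg hf).trans (mul_le_mul' h1 h2)

/-- Hölder's inequality with each of the three factors in turn in `L^∞` and the other two in `L²`.
-/
theorem eLpNorm_term_le (hF : IsDyadicFamily F a) (hG : IsDyadicFamily G b)
    {X : R3 → ℂ} {m₁ m₂ : ℝ} (hX : Integrable X) (hX2 : MemLp X 2 volume) (hm₁ : 0 ≤ m₁)
    (hm₂ : 0 ≤ m₂) (h1 : eLpNorm X 1 volume ≤ ENNReal.ofReal m₁)
    (h2 : eLpNorm X 2 volume ≤ ENNReal.ofReal m₂) (p : ℤ × ℤ) :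
    eLpNorm (term X F G p) 1 volume ≤ ENNReal.ofReal (m₁ * (a p.1 * b p.2)) ∧
    eLpNorm (term X F G p) 1 volume ≤ ENNReal.ofReal
      (m₂ * bernsteinConst * (2 : ℝ) ^ (3 / 2 * (p.1 : ℝ)) * (a p.1 * b p.2)) ∧
    eLpNorm (term X F G p) 1 volume ≤ ENNReal.ofReal
      (m₂ * bernsteinConst * (2 : ℝ) ^ (3 / 2 * (p.2 : ℝ)) * (a p.1 * b p.2)) := by
  have mX : AEStronglyMeasurable (𝓕⁻ X : R3 → ℂ) volume :=
    (continuous_fourierInv_of_integrable hX).aestronglyMeasurable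
  have mF := hF.aestronglyMeasurable p.1
  have mG := hG.aestronglyMeasurable p.2
  have hXt := (eLpNorm_top_fourierInv_le X hX).trans h1
  have hX2' : eLpNorm (𝓕⁻ X : R3 → ℂ) 2 volume ≤ ENNReal.ofReal m₂ := by
    rw [eLpNorm_two_fourierInv hX hX2]; exact h2
  have K0 := bernsteinConst_nonneg
  have ha := hF.nonneg p.1
  have hb := hG.nonneg p.2
  refine ⟨?_, ?_, ?_⟩
  · exact eLpNorm_mul_le mX (mF.mul mG) ∞ 1 1 hm₁ hXt
      (eLpNorm_mul_le mF mG 2 2 1 ha (hF.eLpNorm_two_le _) (hG.eLpNorm_two_le _))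
  · refine (eLpNorm_mul_le mX (mF.mul mG) 2 2 1 hm₂ hX2'
      (eLpNorm_mul_le mF mG ∞ 2 2 (by positivity) (hF.eLpNorm_top_le _)
        (hG.eLpNorm_two_le _))).trans (le_of_eq ?_)
    congr 1; ring
  · refine (eLpNorm_mul_le mX (mF.mul mG) 2 2 1 hm₂ hX2'
      (eLpNorm_mul_le mF mG 2 ∞ 2 ha (hF.eLpNorm_two_le _)
        (hG.eLpNorm_top_le _))).trans (le_of_eq ?_)
    congr 1; ring

end IsDyadicFamily

namespace IsDyadicFamily

variable {F G : ℤ → R3 → ℂ} {a b : ℤ → ℝ}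

/-- It suffices to sum in `L¹` of each ball. For `k ≥ 0` Cauchy–Schwarz on the ball keeps the decay
`2^{-k/2}`; for `k < 0` Bernstein gives the sup bound `2^{3k/2} 2^{-k/2} = 2^k`. -/
theorem ae_summable_norm {A : ℝ} (hF : IsDyadicFamily F a) (hA : 0 ≤ A)
    (ha : ∀ k : ℤ, a k ≤ A * (2 : ℝ) ^ (-(k : ℝ) / 2)) :
    ∀ᵐ x, Summable fun k => ‖𝓕⁻ (F k) x‖ := by
  have key : ∀ R : ℕ, ∀ᵐ x ∂(volume.restrict (Metric.closedBall (0 : R3) R)),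
      Summable fun k => ‖𝓕⁻ (F k) x‖ := fun R => by
    set μ : Measure R3 := volume.restrict (Metric.closedBall (0 : R3) R) with hμ
    have hfin : μ Set.univ < ∞ := by
      rw [hμ, Measure.restrict_apply_univ]; exact measure_closedBall_lt_top
    have K0 := bernsteinConst_nonneg
    set v₁ : ℝ := (μ Set.univ).toReal with hv₁
    set v₂ : ℝ := (μ Set.univ ^ (1 / 2 : ℝ)).toReal with hv₂
    have e₁ : μ Set.univ = ENNReal.ofReal v₁ := (ENNReal.ofReal_toReal hfin.ne).symm
    have e₂ : μ Set.univ ^ (1 / 2 : ℝ) = ENNReal.ofReal v₂ :=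
      (ENNReal.ofReal_toReal (ENNReal.rpow_lt_top_of_nonneg (by norm_num) hfin.ne).ne).symm
    have hv₁0 : 0 ≤ v₁ := ENNReal.toReal_nonneg
    have hv₂0 : 0 ≤ v₂ := ENNReal.toReal_nonneg
    refine ae_summable_norm_of_eLpNorm (c := fun k => A * (v₂ + bernsteinConst * v₁) *
      dyadicDecay 0 k) (fun k => (hF.aestronglyMeasurable k).restrict)
      (fun k => mul_nonneg (by positivity) (dyadicDecay_pos 0 k).le)
      ((summable_dyadicDecay 0).mul_left _) fun k => ?_
    rcases le_or_gt 0 k with hk | hk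
    · have h := eLpNorm_le_eLpNorm_mul_rpow_measure_univ (μ := μ) (p := 1) (q := 2)
        (by norm_num) (f := (𝓕⁻ (F k) : R3 → ℂ)) (hF.aestronglyMeasurable k).restrict
      have e : (1 / (1 : ℝ≥0∞).toReal - 1 / (2 : ℝ≥0∞).toReal) = (1 / 2 : ℝ) := by norm_num
      rw [e, e₂] at h
      refine h.trans ((mul_le_mul_left ((eLpNorm_restrict_le _ _ _ _).trans
        (hF.eLpNorm_two_le k)) _).trans ?_)
      rw [← ENNReal.ofReal_mul (hF.nonneg k)]
      refine ENNReal.ofReal_le_ofReal ?_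
      have hk' : (0 : ℝ) ≤ k := by exact_mod_cast hk
      calc a k * v₂ ≤ A * (2 : ℝ) ^ (-(k : ℝ) / 2) * v₂ := by gcongr; exact ha k
        _ ≤ A * dyadicDecay 0 k * v₂ := by
            gcongr
            refine Real.rpow_le_rpow_of_exponent_le (by norm_num) ?_
            rw [Int.cast_zero, sub_zero, abs_of_nonneg hk']
            linarith
        _ = A * v₂ * dyadicDecay 0 k := by ring
        _ ≤ _ := by
            have := dyadicDecay_pos 0 k
            gcongr
            exact le_add_of_nonneg_right (by positivity)
    · have h := eLpNorm_le_eLpNorm_mul_rpow_measure_univ (μ := μ) (p := 1) (q := ∞)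
        (by simp) (f := (𝓕⁻ (F k) : R3 → ℂ)) (hF.aestronglyMeasurable k).restrict
      have e : (1 / (1 : ℝ≥0∞).toReal - 1 / (∞ : ℝ≥0∞).toReal) = (1 : ℝ) := by norm_num
      rw [e, ENNReal.rpow_one, e₁] at h
      have := hF.nonneg k
      refine h.trans ((mul_le_mul_left ((eLpNorm_restrict_le _ _ _ _).trans
        (hF.eLpNorm_top_le k)) _).trans ?_)
      rw [← ENNReal.ofReal_mul (by positivity)]
      refine ENNReal.ofReal_le_ofReal ?_
      have hk' : (k : ℝ) < 0 := by exact_mod_cast hk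
      calc a k * (bernsteinConst * (2 : ℝ) ^ (3 / 2 * (k : ℝ))) * v₁
          ≤ A * (2 : ℝ) ^ (-(k : ℝ) / 2) * (bernsteinConst * (2 : ℝ) ^ (3 / 2 * (k : ℝ))) *
            v₁ := by gcongr; exact ha k
        _ = A * (bernsteinConst * v₁) * (2 : ℝ) ^ (-(k : ℝ) / 2 + 3 / 2 * (k : ℝ)) := by
            rw [Real.rpow_add (by norm_num)]; ring
        _ ≤ A * (bernsteinConst * v₁) * dyadicDecay 0 k := by
            refine mul_le_mul_of_nonneg_left ?_ (by positivity)
            refine Real.rpow_le_rpow_of_exponent_le (by norm_num) ?_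
            rw [Int.cast_zero, sub_zero, abs_of_neg hk']
            linarith
        _ ≤ _ := by
            have := dyadicDecay_pos 0 k
            gcongr
            exact le_add_of_nonneg_left hv₂0
  have h2 := ae_all_iff.mpr fun R : ℕ =>
    (ae_restrict_iff' Metric.isClosed_closedBall.measurableSet).mp (key R)
  filter_upwards [h2] with x hx
  obtain ⟨R, hR⟩ := exists_nat_ge ‖x‖
  exact hx R (mem_closedBall_zero_iff.mpr hR)

section Trilinear

variable {X U V : R3 → ℂ} {m₁ m₂ A B : ℝ}

/-- `X` need not be localised here, so the decay is centred at `0` and low–low terms are controlled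
by the unweighted bound on `b`. This yields absolute convergence of the pairing, not the scaling in
`j`. -/
theorem eLpNorm_term_le_decay (hF : IsDyadicFamily F a) (hG : IsDyadicFamily G b)
    (hX : Integrable X) (hX2 : MemLp X 2 volume) (hm₁ : 0 ≤ m₁)
    (hm₂ : 0 ≤ m₂) (h1 : eLpNorm X 1 volume ≤ ENNReal.ofReal m₁)
    (h2 : eLpNorm X 2 volume ≤ ENNReal.ofReal m₂) (hA : 0 ≤ A) (hB : 0 ≤ B)
    (ha : ∀ k : ℤ, a k ≤ A * (2 : ℝ) ^ (-(k : ℝ) / 2))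
    (hb : ∀ k : ℤ, b k ≤ B * (2 : ℝ) ^ (-(k : ℝ) / 2)) (p : ℤ × ℤ) :
    eLpNorm (term X F G p) 1 volume ≤ ENNReal.ofReal ((m₁ + m₂ * bernsteinConst) * A * B *
      (dyadicDecay 0 p.1 * dyadicDecay 0 p.2)) := by
  obtain ⟨t1, t2, t3⟩ := hF.eLpNorm_term_le hG hX hX2 hm₁ hm₂ h1 h2 p
  have K0 := bernsteinConst_nonneg
  have ha0 := hF.nonneg p.1
  have hb0 := hG.nonneg p.2
  have hfin : eLpNorm (term X F G p) 1 volume ≠ ∞ := (t1.trans_lt ENNReal.ofReal_lt_top).ne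
  have h := dyadic_term_le (t := (eLpNorm (term X F G p) 1 volume).toReal) (n := 0)
    (m₂ := m₂ * bernsteinConst) hm₁ (by positivity) hA hB hb0
    (ENNReal.toReal_le_of_le_ofReal (by positivity) t1)
    (ENNReal.toReal_le_of_le_ofReal (by positivity) t2)
    (ENNReal.toReal_le_of_le_ofReal (by positivity) t3) (ha p.1)
    ((hb p.2).trans (mul_le_mul_of_nonneg_left (Real.rpow_le_rpow_of_exponent_le (by norm_num)
      (le_add_of_nonneg_right (by positivity))) hB)) (fun _ _ => Or.inr (hb p.2))
  rw [← ENNReal.ofReal_toReal hfin]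
  refine ENNReal.ofReal_le_ofReal (h.trans (le_of_eq ?_))
  simp

theorem trilinear_ae_eq_tsum (hF : IsDyadicFamily F a) (hG : IsDyadicFamily G b)
    (hA : 0 ≤ A) (hB : 0 ≤ B)
    (ha : ∀ k : ℤ, a k ≤ A * (2 : ℝ) ^ (-(k : ℝ) / 2))
    (hb : ∀ k : ℤ, b k ≤ B * (2 : ℝ) ^ (-(k : ℝ) / 2))
    (hU : ∀ᵐ x, U x = ∑' k, 𝓕⁻ (F k) x) (hV : ∀ᵐ x, V x = ∑' k, 𝓕⁻ (G k) x) :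
    (fun x => 𝓕⁻ X x * (U x * V x)) =ᵐ[volume] fun x => ∑' p, term X F G p x := by
  filter_upwards [hU, hV, hF.ae_summable_norm hA ha, hG.ae_summable_norm hB hb] with x h1 h2 h3 h4
  rw [h1, h2, tsum_mul_tsum_of_summable_norm h3 h4, ← tsum_mul_left]
  rfl

theorem integrable_trilinear (hF : IsDyadicFamily F a) (hG : IsDyadicFamily G b)
    (hX : Integrable X) (hX2 : MemLp X 2 volume) (hA : 0 ≤ A) (hB : 0 ≤ B)
    (ha : ∀ k : ℤ, a k ≤ A * (2 : ℝ) ^ (-(k : ℝ) / 2))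
    (hb : ∀ k : ℤ, b k ≤ B * (2 : ℝ) ^ (-(k : ℝ) / 2))
    (hU : ∀ᵐ x, U x = ∑' k, 𝓕⁻ (F k) x) (hV : ∀ᵐ x, V x = ∑' k, 𝓕⁻ (G k) x) :
    Integrable (fun x => 𝓕⁻ X x * (U x * V x)) ∧
    HasSum (fun p => ∫ x, term X F G p x) (∫ x, 𝓕⁻ X x * (U x * V x)) := by
  have hX1 : MemLp X 1 volume := memLp_one_iff_integrable.mpr hX
  set m₁ : ℝ := (eLpNorm X 1 volume).toReal with hm₁
  set m₂ : ℝ := (eLpNorm X 2 volume).toReal with hm₂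
  have h1 : eLpNorm X 1 volume ≤ ENNReal.ofReal m₁ := (ENNReal.ofReal_toReal hX1.2.ne).ge
  have h2 : eLpNorm X 2 volume ≤ ENNReal.ofReal m₂ := (ENNReal.ofReal_toReal hX2.2.ne).ge
  have hm₁0 : 0 ≤ m₁ := ENNReal.toReal_nonneg
  have hm₂0 : 0 ≤ m₂ := ENNReal.toReal_nonneg
  have K0 := bernsteinConst_nonneg
  have hae := trilinear_ae_eq_tsum (X := X) hF hG hA hB ha hb hU hV
  have hm := hF.aestronglyMeasurable_term hG hX
  have hc0 : ∀ p : ℤ × ℤ, 0 ≤ (m₁ + m₂ * bernsteinConst) * A * B *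
      (dyadicDecay 0 p.1 * dyadicDecay 0 p.2) := fun p => by
    have := dyadicDecay_pos 0 p.1
    have := dyadicDecay_pos 0 p.2
    positivity
  have hc := (hasSum_dyadicDecay_mul 0 ((m₁ + m₂ * bernsteinConst) * A * B)).summable
  have hle := hF.eLpNorm_term_le_decay hG hX hX2 hm₁0 hm₂0 h1 h2 hA hB ha hb
  refine ⟨(integrable_tsum_of_eLpNorm hm hc0 hc hle).congr hae.symm, ?_⟩
  rw [integral_congr_ae hae]
  exact hasSum_integral_of_eLpNorm hm hc0 hc hle

theorem norm_integral_term_le (hF : IsDyadicFamily F a) (hG : IsDyadicFamily G b)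
    (hX : Integrable X) (p : ℤ × ℤ) {t : ℝ} (ht : 0 ≤ t)
    (h : eLpNorm (term X F G p) 1 volume ≤ ENNReal.ofReal t) :
    ‖∫ x, term X F G p x‖ ≤ t := by
  have hi : Integrable (term X F G p) := memLp_one_iff_integrable.mp
    ⟨hF.aestronglyMeasurable_term hG hX p, h.trans_lt ENNReal.ofReal_lt_top⟩
  refine (norm_integral_le_integral_norm _).trans ?_
  rw [← ENNReal.ofReal_le_ofReal_iff ht, ofReal_integral_norm_eq_lintegral_enorm hi,
    ← eLpNorm_one_eq_lintegral_enorm]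
  exact h

theorem norm_trilinear_le (hF : IsDyadicFamily F a) (hG : IsDyadicFamily G b)
    (hX : Integrable X) (hX2 : MemLp X 2 volume) (hm₁ : 0 ≤ m₁)
    (hm₂ : 0 ≤ m₂) (h1 : eLpNorm X 1 volume ≤ ENNReal.ofReal m₁)
    (h2 : eLpNorm X 2 volume ≤ ENNReal.ofReal m₂) (hA : 0 ≤ A) (hB : 0 ≤ B)
    (ha : ∀ k : ℤ, a k ≤ A * (2 : ℝ) ^ (-(k : ℝ) / 2))
    (hb : ∀ k : ℤ, b k ≤ B * (2 : ℝ) ^ (-(k : ℝ) / 2))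
    (hU : ∀ᵐ x, U x = ∑' k, 𝓕⁻ (F k) x) (hV : ∀ᵐ x, V x = ∑' k, 𝓕⁻ (G k) x) :
    ‖∫ x, 𝓕⁻ X x * (U x * V x)‖ ≤
      (m₁ + m₂ * bernsteinConst) * A * B * dyadicSum ^ 2 := by
  have K0 := bernsteinConst_nonneg
  rw [← (hF.integrable_trilinear hG hX hX2 hA hB ha hb hU hV).2.tsum_eq]
  refine tsum_of_norm_bounded (hasSum_dyadicDecay_mul 0 _) fun p => ?_
  have := dyadicDecay_pos 0 p.1
  have := dyadicDecay_pos 0 p.2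
  exact hF.norm_integral_term_le hG hX p (by positivity)
    (hF.eLpNorm_term_le_decay hG hX hX2 hm₁ hm₂ h1 h2 hA hB ha hb p)

/-- Indices at most `j - 3` give product frequencies at most `2 · (8/3) · 2^j / 8 = (2/3) 2^j`,
below the inner radius `(3/4) 2^j`. -/
theorem integral_term_eq_zero (hF : IsDyadicFamily F a) (hG : IsDyadicFamily G b)
    (hX : Integrable X) {j : ℤ} (hXs : ∀ ξ, X ξ ≠ 0 → ξ ∈ annulus j) {p : ℤ × ℤ}
    (h1 : p.1 < j - 2) (h2 : p.2 < j - 2) : ∫ x, term X F G p x = 0 := by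
  have hpi : 0 < 2 * Real.pi := by positivity
  have hn : ∀ ξ : R3, ‖(2 * Real.pi) • ξ‖ = 2 * Real.pi * ‖ξ‖ := fun ξ => by
    rw [norm_smul, Real.norm_of_nonneg hpi.le]
  have hz : ∀ k : ℤ, k < j - 2 → (2 : ℝ) ^ k ≤ 1 / 8 * (2 : ℝ) ^ j := fun k hk => by
    have : (2 : ℝ) ^ k ≤ (2 : ℝ) ^ (j - 3) := zpow_le_zpow_right₀ (by norm_num) (by lia)
    refine this.trans (le_of_eq ?_)
    rw [zpow_sub₀ (by norm_num)]
    norm_num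
    ring
  have hpos : (0 : ℝ) < 2 ^ j := by positivity
  refine integral_fourierInv_mul_mul_eq_zero (ρ := 3 / 4 * (2 : ℝ) ^ j / (2 * Real.pi))
    (r := 8 / 3 * (2 : ℝ) ^ p.1 / (2 * Real.pi)) (s := 8 / 3 * (2 : ℝ) ^ p.2 / (2 * Real.pi)) hX
    (hF.integrable _) (hF.memLp _) (hG.integrable _) (hG.memLp _) (fun ξ hξ => ?_)
    (fun ξ hξ => ?_) (fun ξ hξ => ?_) ?_
  · have := (hXs ξ hξ).1
    rw [hn] at this
    rw [div_le_iff₀ hpi]; linarith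
  · have := (hF.support _ ξ hξ).2
    rw [hn] at this
    rw [le_div_iff₀ hpi]; linarith
  · have := (hG.support _ ξ hξ).2
    rw [hn] at this
    rw [le_div_iff₀ hpi]; linarith
  · rw [← add_div]
    refine div_lt_div_of_pos_right ?_ hpi
    have := hz _ h1
    have := hz _ h2
    linarith

/-- The bilinear estimate tested against functions with frequencies of size `2^j`. -/
theorem norm_trilinear_localized_le (hF : IsDyadicFamily F a) (hG : IsDyadicFamily G b)
    (hX2 : MemLp X 2 volume) {j : ℤ} (hXs : ∀ ξ, X ξ ≠ 0 → ξ ∈ annulus j)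
    (hm₂ : 0 ≤ m₂) (h2 : eLpNorm X 2 volume ≤ ENNReal.ofReal m₂) (hA : 0 ≤ A) (hB : 0 ≤ B)
    (ha : ∀ k : ℤ, a k ≤ A * (2 : ℝ) ^ (-(k : ℝ) / 2))
    (hb : ∀ k : ℤ, b k ≤ B * (2 : ℝ) ^ (-(k : ℝ) / 2)) {W : ℝ} (hW : 0 ≤ W)
    (hbW : ∀ k : ℤ, b k ≤ W * (2 : ℝ) ^ (-(k : ℝ) / 2 + max ((j : ℝ) - k) 0 / 2))
    (hU : ∀ᵐ x, U x = ∑' k, 𝓕⁻ (F k) x) (hV : ∀ᵐ x, V x = ∑' k, 𝓕⁻ (G k) x) :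
    ‖∫ x, 𝓕⁻ X x * (U x * V x)‖ ≤
      10 * bernsteinConst * dyadicSum ^ 2 * A * W * (2 : ℝ) ^ ((j : ℝ) / 2) * m₂ := by
  have K0 := bernsteinConst_nonneg
  have hX : Integrable X := integrable_of_annulus hX2 hXs
  -- Since `X` lives on one annulus, Bernstein controls its `L¹` norm by its `L²` norm.
  set m₁ : ℝ := m₂ * (bernsteinConst * (2 : ℝ) ^ (3 / 2 * (j : ℝ))) with hm₁
  have hm₁0 : 0 ≤ m₁ := by positivity
  have h1 : eLpNorm X 1 volume ≤ ENNReal.ofReal m₁ := by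
    refine (eLpNorm_one_le_of_annulus hX2.1 hXs).trans ?_
    rw [hm₁, ENNReal.ofReal_mul hm₂]
    exact mul_le_mul_left h2 _
  rw [← (hF.integrable_trilinear hG hX hX2 hA hB ha hb hU hV).2.tsum_eq]
  have hterm : ∀ p : ℤ × ℤ, ‖∫ x, term X F G p x‖ ≤
      (m₁ * (2 : ℝ) ^ (-((j - 2 : ℤ) : ℝ)) + m₂ * bernsteinConst *
        (2 : ℝ) ^ (((j - 2 : ℤ) : ℝ) / 2)) * A * (2 * W) *
        (dyadicDecay (j - 2) p.1 * dyadicDecay (j - 2) p.2) := fun p => by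
    obtain ⟨t1, t2, t3⟩ := hF.eLpNorm_term_le hG hX hX2 hm₁0 hm₂ h1 h2 p
    have ha0 := hF.nonneg p.1
    have hb0 := hG.nonneg p.2
    refine dyadic_term_le hm₁0 (by positivity) hA (by positivity) hb0
      (hF.norm_integral_term_le hG hX p (by positivity) t1)
      (hF.norm_integral_term_le hG hX p (by positivity) t2)
      (hF.norm_integral_term_le hG hX p (by positivity) t3) (ha p.1) ((hbW p.2).trans ?_)
      (fun hk hl => Or.inl ?_)
    · have e : (2 * W) * (2 : ℝ) ^ (-(p.2 : ℝ) / 2 + max (((j - 2 : ℤ) : ℝ) - p.2) 0 / 2)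
          = W * (2 : ℝ) ^ (1 + (-(p.2 : ℝ) / 2 + max (((j - 2 : ℤ) : ℝ) - p.2) 0 / 2)) := by
        rw [Real.rpow_add (x := 2) (by norm_num) 1, Real.rpow_one]; ring
      rw [e]
      refine mul_le_mul_of_nonneg_left ?_ hW
      refine Real.rpow_le_rpow_of_exponent_le (by norm_num) ?_
      push_cast
      have : max ((j : ℝ) - p.2) 0 ≤ max ((j : ℝ) - 2 - p.2) 0 + 2 := by
        refine max_le ?_ ?_
        · linarith [le_max_left ((j : ℝ) - 2 - p.2) 0]
        · linarith [le_max_right ((j : ℝ) - 2 - p.2) 0]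
      linarith
    · rw [hF.integral_term_eq_zero hG hX hXs hk hl, norm_zero]
  refine (tsum_of_norm_bounded (hasSum_dyadicDecay_mul (j - 2) _) hterm).trans ?_
  -- The factor `4` comes from the shift by two. With the second summand and the doubled `W` the
  -- final constant is `(4 + 1) · 2 = 10`.
  have e1 : m₁ * (2 : ℝ) ^ (-((j - 2 : ℤ) : ℝ))
      = 4 * (m₂ * bernsteinConst * (2 : ℝ) ^ ((j : ℝ) / 2)) := by
    have : (2 : ℝ) ^ (3 / 2 * (j : ℝ)) * (2 : ℝ) ^ (-((j - 2 : ℤ) : ℝ))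
        = 4 * (2 : ℝ) ^ ((j : ℝ) / 2) := by
      have h4 : (4 : ℝ) = (2 : ℝ) ^ (2 : ℝ) := by norm_num
      rw [h4, ← Real.rpow_add (by norm_num), ← Real.rpow_add (by norm_num)]
      congr 1; push_cast; ring
    rw [hm₁]
    linear_combination m₂ * bernsteinConst * this
  have e2 : (2 : ℝ) ^ (((j - 2 : ℤ) : ℝ) / 2) ≤ (2 : ℝ) ^ ((j : ℝ) / 2) := by
    refine Real.rpow_le_rpow_of_exponent_le (by norm_num) ?_
    push_cast; linarith
  rw [e1]
  have hD := dyadicSum_nonneg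
  calc (4 * (m₂ * bernsteinConst * (2 : ℝ) ^ ((j : ℝ) / 2)) + m₂ * bernsteinConst *
        (2 : ℝ) ^ (((j - 2 : ℤ) : ℝ) / 2)) * A * (2 * W) * dyadicSum ^ 2
      ≤ (4 * (m₂ * bernsteinConst * (2 : ℝ) ^ ((j : ℝ) / 2)) + m₂ * bernsteinConst *
        (2 : ℝ) ^ ((j : ℝ) / 2)) * A * (2 * W) * dyadicSum ^ 2 := by gcongr
    _ = _ := by ring

end Trilinear

end IsDyadicFamily

/-! ### Weak and strong measurability -/

/-- Orthonormal vectors are at distance `√2`, so the balls of radius `1/2` around them are disjoint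
open sets. -/
theorem Orthonormal.countable_of_separable {H ι : Type*} [NormedAddCommGroup H]
    [InnerProductSpace ℂ H] [TopologicalSpace.SeparableSpace H] {v : ι → H}
    (hv : Orthonormal ℂ v) : Countable ι := by
  refine Pairwise.countable_of_isOpen_disjoint (s := fun i => Metric.ball (v i) (1 / 2))
    (fun i j hij => Metric.ball_disjoint_ball ?_) (fun i => Metric.isOpen_ball)
    (fun i => ⟨v i, Metric.mem_ball_self (by norm_num)⟩)
  have h : ‖v i - v j‖ ^ 2 = 2 := by
    rw [@norm_sub_sq ℂ, hv.1 i, hv.1 j, hv.2 hij]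
    norm_num
  rw [dist_eq_norm]
  nlinarith [norm_nonneg (v i - v j)]

/-- Pettis' theorem in a separable Hilbert space. -/
theorem aestronglyMeasurable_of_inner {H α : Type*} [NormedAddCommGroup H]
    [InnerProductSpace ℂ H] [CompleteSpace H] [TopologicalSpace.SeparableSpace H]
    [MeasurableSpace α] {μ : Measure α} {h : α → H}
    (hm : ∀ w : H, AEStronglyMeasurable (fun a => inner ℂ w (h a)) μ) :
    AEStronglyMeasurable h μ := by
  obtain ⟨w, b, -⟩ := exists_hilbertBasis ℂ H
  have : Countable w := b.orthonormal.countable_of_separable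
  refine aestronglyMeasurable_of_tendsto_ae (Filter.atTop : Filter (Finset w))
    (f := fun s a => ∑ i ∈ s, inner ℂ (b i) (h a) • b i) (fun s => ?_)
    (Filter.Eventually.of_forall fun a => ?_)
  · exact Finset.aestronglyMeasurable_fun_sum s fun i _ => (hm (b i)).smul_const _
  · have := b.hasSum_repr (h a)
    simp only [b.repr_apply_apply] at this
    exact this

theorem aestronglyMeasurable_of_inner_dense {H α : Type*} [NormedAddCommGroup H]
    [InnerProductSpace ℂ H] [CompleteSpace H] [TopologicalSpace.SeparableSpace H]
    [MeasurableSpace α] {μ : Measure α} {h : α → H} {S : Set H} (hS : Dense S)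
    (hm : ∀ w ∈ S, AEStronglyMeasurable (fun a => inner ℂ w (h a)) μ) :
    AEStronglyMeasurable h μ := by
  refine aestronglyMeasurable_of_inner fun w => ?_
  obtain ⟨x, hx, hlim⟩ := mem_closure_iff_seq_limit.mp (hS w)
  refine aestronglyMeasurable_of_tendsto_ae Filter.atTop (fun n => hm (x n) (hx n))
    (Filter.Eventually.of_forall fun a => ?_)
  exact hlim.inner tendsto_const_nhds

/-- The conjugate of the `i`-th component of a Schwartz field. -/
def conjComponent (Ψ : 𝓢(R3, C3)) (i : Fin 3) : 𝓢(R3, ℂ) :=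
  SchwartzMap.postcompCLM (𝕜 := ℝ) ((Complex.conjCLE : ℂ →L[ℝ] ℂ) ∘L
    ((EuclideanSpace.proj i : C3 →L[ℂ] ℂ).restrictScalars ℝ)) Ψ

theorem inner_toLp_eq_sum (Ψ : 𝓢(R3, C3)) (g : Lp C3 2 (volume : Measure R3)) :
    inner ℂ (Ψ.toLp 2) g = ∑ i, ((g : 𝓢'(R3, C3)) (conjComponent Ψ i)) i := by
  have hint : ∀ i, Integrable (fun x => conjComponent Ψ i x • g x) := fun i =>
    memLp_one_iff_integrable.mp ((Lp.memLp g).smul ((conjComponent Ψ i).memLp 2 volume))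
  have h1 : ∀ i, ((g : 𝓢'(R3, C3)) (conjComponent Ψ i)) i
      = ∫ x, (starRingEnd ℂ) (Ψ x i) * g x i := fun i => by
    rw [Lp.toTemperedDistribution_apply]
    exact ((EuclideanSpace.proj i : C3 →L[ℂ] ℂ).integral_comp_comm (hint i)).symm
  have hint2 : ∀ i, Integrable (fun x => (starRingEnd ℂ) (Ψ x i) * g x i) := fun i =>
    (EuclideanSpace.proj i : C3 →L[ℂ] ℂ).integrable_comp (hint i)
  simp_rw [h1]
  rw [← integral_finsetSum _ fun i _ => hint2 i, L2.inner_def]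
  refine integral_congr_ae ?_
  filter_upwards [Ψ.coeFn_toLp 2 volume] with x hx
  rw [hx, PiLp.inner_apply]
  simp [RCLike.inner_apply, mul_comm]

/-- The inner product with a Schwartz field is a finite sum of components of `u a` at elements of
`𝒵`, measurable by hypothesis. Schwartz fields are dense in `L²`, and Pettis' theorem applies. -/
theorem aestronglyMeasurable_l2Rep_delta {α : Type*} [MeasurableSpace α] {μ : Measure α}
    (Φ : LPCutoff) (k : ℤ) {u : α → ZDual}
    (hm : ∀ ψ : ZSpace, AEStronglyMeasurable (fun a => u a ψ) μ)
    (hfin : ∀ᵐ a ∂μ, l2Norm (Φ.delta k (u a)) < ∞) :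
    AEStronglyMeasurable (fun a => l2Rep (Φ.delta k (u a))) μ := by
  have : Fact ((2 : ℝ≥0∞) ≠ ∞) := ⟨by simp⟩
  refine aestronglyMeasurable_of_inner_dense
    (SchwartzMap.denseRange_toLpCLM (E := R3) (F := C3) (p := 2) (μ := volume)
      ENNReal.ofNat_ne_top) ?_
  rintro _ ⟨Ψ, rfl⟩
  have h : AEStronglyMeasurable
      (fun a => ∑ i, (u a (Φ.deltaZ k (conjComponent Ψ i))) i) μ :=
    Finset.aestronglyMeasurable_fun_sum _ fun i _ =>
      (EuclideanSpace.proj i : C3 →L[ℂ] ℂ).continuous.comp_aestronglyMeasurable (hm _)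
  refine h.congr ?_
  filter_upwards [hfin] with a ha
  have e := inner_toLp_eq_sum Ψ (l2Rep (Φ.delta k (u a)))
  rw [(l2Rep_spec ha).1] at e
  exact e.symm

/-! ### Functions of the Besov space -/

section Besov

variable {Φ : LPCutoff} {f : ZDual} {A : ℝ}

theorem two_rpow_ofReal (x : ℝ) : (2 : ℝ≥0∞) ^ x = ENNReal.ofReal ((2 : ℝ) ^ x) := by
  rw [← ENNReal.ofReal_rpow_of_pos (by norm_num)]
  norm_num

theorem l2Norm_delta_le (h : besovNorm Φ (1 / 2) f ≤ ENNReal.ofReal A) (k : ℤ) :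
    l2Norm (Φ.delta k f) ≤ ENNReal.ofReal (A * (2 : ℝ) ^ (-(k : ℝ) / 2)) := by
  have h1 := (le_iSup (fun j : ℤ => (2 : ℝ≥0∞) ^ ((j : ℝ) * (1 / 2)) * l2Norm (Φ.delta j f))
    k).trans h
  rw [two_rpow_ofReal] at h1
  calc l2Norm (Φ.delta k f)
      = ENNReal.ofReal ((2 : ℝ) ^ (-(k : ℝ) / 2)) *
        (ENNReal.ofReal ((2 : ℝ) ^ ((k : ℝ) * (1 / 2))) * l2Norm (Φ.delta k f)) := by
        rw [← mul_assoc, ← ENNReal.ofReal_mul (by positivity), ← Real.rpow_add (by norm_num)]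
        have : -(k : ℝ) / 2 + (k : ℝ) * (1 / 2) = 0 := by ring
        rw [this]; simp
    _ ≤ ENNReal.ofReal ((2 : ℝ) ^ (-(k : ℝ) / 2)) * ENNReal.ofReal A := by gcongr
    _ = _ := by rw [← ENNReal.ofReal_mul (by positivity), mul_comm]

theorem l2Norm_delta_lt_top (h : besovNorm Φ (1 / 2) f ≤ ENNReal.ofReal A)
    (k : ℤ) : l2Norm (Φ.delta k f) < ∞ :=
  (l2Norm_delta_le h k).trans_lt ENNReal.ofReal_lt_top

theorem toReal_l2Norm_delta_le (hA : 0 ≤ A) (h : besovNorm Φ (1 / 2) f ≤ ENNReal.ofReal A)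
    (k : ℤ) : (l2Norm (Φ.delta k f)).toReal ≤ A * (2 : ℝ) ^ (-(k : ℝ) / 2) :=
  ENNReal.toReal_le_of_le_ofReal (by positivity) (l2Norm_delta_le h k)

theorem isDyadicFamily_blockSpectrum (hf : ∀ k, l2Norm (Φ.delta k f) < ∞) (i : Fin 3) :
    IsDyadicFamily (fun k => blockSpectrum Φ k f i)
      (fun k => (l2Norm (Φ.delta k f)).toReal) where
  memLp k := memLp_blockSpectrum Φ k f i
  support k := mem_annulus_of_blockSpectrum_ne_zero Φ k f i
  nonneg _ := ENNReal.toReal_nonneg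
  bound k := by
    rw [ENNReal.ofReal_toReal (hf k).ne, ← (l2Rep_spec (hf k)).2]
    exact eLpNorm_blockSpectrum_le Φ k f i

theorem realization_apply_ae_eq (hA : 0 ≤ A) (h : besovNorm Φ (1 / 2) f ≤ ENNReal.ofReal A)
    (i : Fin 3) :
    ∀ᵐ x, realization Φ f x i = ∑' k, 𝓕⁻ (blockSpectrum Φ k f i) x := by
  have hs : ∀ i : Fin 3, ∀ᵐ x, Summable fun k => ‖𝓕⁻ (blockSpectrum Φ k f i) x‖ := fun i =>
    (isDyadicFamily_blockSpectrum (l2Norm_delta_lt_top h) i).ae_summable_norm hA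
      (toReal_l2Norm_delta_le hA h)
  have he : ∀ᵐ x, ∀ (i : Fin 3) (k : ℤ), (l2Rep (Φ.delta k f) : R3 → C3) x i
      = 𝓕⁻ (blockSpectrum Φ k f i) x :=
    ae_all_iff.mpr fun i => ae_all_iff.mpr fun k => l2Rep_delta_apply_ae_eq Φ k f i
  filter_upwards [he, ae_all_iff.mpr hs] with x hx hsx
  -- A coordinate may be taken inside `tsum` only for a summable series; otherwise `tsum` is the
  -- default value `0`.
  have hsum : Summable fun k : ℤ => (l2Rep (Φ.delta k f) : R3 → C3) x := by
    refine Summable.of_norm_bounded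
      (g := fun k => ∑ i, ‖𝓕⁻ (blockSpectrum Φ k f i) x‖) (summable_sum fun i _ => hsx i)
      fun k => ?_
    have e : (l2Rep (Φ.delta k f) : R3 → C3) x
        = ∑ i, EuclideanSpace.single i ((l2Rep (Φ.delta k f) : R3 → C3) x i) := by
      ext j
      simp [Fin.sum_univ_three]
      fin_cases j <;> simp
    rw [e]
    refine (norm_sum_le _ _).trans (le_of_eq ?_)
    refine Finset.sum_congr rfl fun i _ => ?_
    rw [PiLp.norm_single, hx]
  have := (EuclideanSpace.proj i : C3 →L[ℂ] ℂ).map_tsum hsum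
  rw [realization]
  refine this.trans (tsum_congr fun k => hx i k)

end Besov

/-! ### The pairing of a product with the transposed multiplier -/

section Pairing

variable {ν : ℝ} (Ω : ℝ) (i l k : Fin 3) (ψ : 𝓢(R3, ℂ))

/-- Time is clamped at `0` because the heat factor is bounded only forward in time. Dominated
convergence then applies with the majorant of `norm_duhamelSpectrum_le`. -/
theorem continuous_fourierInv_duhamelSpectrum_time (hν : 0 ≤ ν) (x : R3) :
    Continuous fun s : ℝ => 𝓕⁻ (duhamelSpectrum ν Ω (max s 0) i l k ψ) x := by
  simp only [Real.fourierInv_eq]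
  refine continuous_of_dominated (bound := fun ξ => 12 * ‖freqMul l ψ ξ‖) (fun s => ?_)
    (fun s => Filter.Eventually.of_forall fun ξ => ?_) ((freqMul l ψ).integrable.norm.const_mul 12)
    (Filter.Eventually.of_forall fun ξ => ?_)
  · have h := (Real.fourierIntegral_convergent_iff (μ := volume)
      (f := duhamelSpectrum ν Ω (max s 0) i l k ψ) (-x)).2
      (integrable_duhamelSpectrum Ω i l k ψ hν (le_max_right s 0))
    simpa using h.1
  · rw [Circle.norm_smul]
    exact norm_duhamelSpectrum_le Ω i l k ψ hν (le_max_right s 0) ξ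
  · refine Continuous.const_smul ?_ _
    unfold duhamelSpectrum
    exact ((continuous_duhamelSymbol_time ν Ω i l k _).comp
      (continuous_id.max continuous_const)).mul continuous_const

theorem norm_fourierInv_duhamelSpectrum_le (hν : 0 ≤ ν) {s : ℝ} (hs : 0 ≤ s) (x : R3) :
    ‖𝓕⁻ (duhamelSpectrum ν Ω s i l k ψ) x‖ ≤ 12 * ∫ ξ, ‖freqMul l ψ ξ‖ := by
  refine (norm_fourierInv_le_integral_norm _ x).trans ?_
  rw [← integral_const_mul]
  exact integral_mono (integrable_duhamelSpectrum Ω i l k ψ hν hs).norm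
    ((freqMul l ψ).integrable.norm.const_mul 12) (norm_duhamelSpectrum_le Ω i l k ψ hν hs)

/-- Continuity in time for fixed `p`, together with a Lipschitz bound in `L¹` uniform in time, gives
joint continuity. Composition with measurable maps into `ℝ × L¹` is then measurable. -/
theorem continuous_integral_fourierInv_duhamelSpectrum_mul (hν : 0 ≤ ν) :
    Continuous fun q : ℝ × Lp ℂ 1 (volume : Measure R3) =>
      ∫ x, 𝓕⁻ (duhamelSpectrum ν Ω (max q.1 0) i l k ψ) x * q.2 x := by
  set M : ℝ := 12 * ∫ ξ, ‖freqMul l ψ ξ‖ with hM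
  have hM0 : 0 ≤ M := mul_nonneg (by norm_num) (integral_nonneg fun _ => norm_nonneg _)
  have hbd : ∀ (s : ℝ) (x : R3), ‖𝓕⁻ (duhamelSpectrum ν Ω (max s 0) i l k ψ) x‖ ≤ M := fun s x =>
    norm_fourierInv_duhamelSpectrum_le Ω i l k ψ hν (le_max_right s 0) x
  have hmeas : ∀ s : ℝ, AEStronglyMeasurable
      (𝓕⁻ (duhamelSpectrum ν Ω (max s 0) i l k ψ) : R3 → ℂ) volume := fun s =>
    (continuous_fourierInv_of_integrable
      (integrable_duhamelSpectrum Ω i l k ψ hν (le_max_right s 0))).aestronglyMeasurable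
  have hint : ∀ (s : ℝ) (p : Lp ℂ 1 (volume : Measure R3)),
      Integrable fun x => 𝓕⁻ (duhamelSpectrum ν Ω (max s 0) i l k ψ) x * p x := fun s p =>
    (L1.integrable_coeFn p).bdd_mul (hmeas s) (Filter.Eventually.of_forall (hbd s))
  refine continuous_prod_of_continuous_lipschitzWith' _ ⟨M, hM0⟩ (fun s => ?_) (fun p => ?_)
  · refine LipschitzWith.of_dist_le_mul fun p q => ?_
    rw [dist_eq_norm, dist_eq_norm, ← integral_sub (hint s p) (hint s q), L1.norm_eq_integral_norm]
    change _ ≤ M * _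
    rw [← integral_const_mul]
    refine (norm_integral_le_integral_norm _).trans ?_
    refine integral_mono_ae ((hint s p).sub (hint s q)).norm
      ((L1.integrable_coeFn (p - q)).norm.const_mul M) ?_
    filter_upwards [Lp.coeFn_sub p q] with x hx
    simp only [hx, Pi.sub_apply]
    rw [← mul_sub, norm_mul]
    exact mul_le_mul_of_nonneg_right (hbd s x) (norm_nonneg _)
  · refine continuous_of_dominated (bound := fun x => M * ‖p x‖) (fun s => (hint s p).1)
      (fun s => Filter.Eventually.of_forall fun x => ?_)
      ((L1.integrable_coeFn p).norm.const_mul M) (Filter.Eventually.of_forall fun x => ?_)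
    · rw [norm_mul]
      exact mul_le_mul_of_nonneg_right (hbd s x) (norm_nonneg _)
    · exact (continuous_fourierInv_duhamelSpectrum_time Ω i l k ψ hν x).mul
        (continuous_const (y := p x))

/-- The product of two components, as a continuous bilinear map from `L²` to `L¹`. -/
def componentMul (l k : Fin 3) : Lp C3 2 (volume : Measure R3) →L[ℂ]
    Lp C3 2 (volume : Measure R3) →L[ℂ] Lp ℂ 1 (volume : Measure R3) :=
  ((ContinuousLinearMap.mul ℂ ℂ).bilinearComp
    (EuclideanSpace.proj l : C3 →L[ℂ] ℂ) (EuclideanSpace.proj k : C3 →L[ℂ] ℂ)).holderL volume 2 2 1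

theorem componentMul_ae_eq (l k : Fin 3) (f g : Lp C3 2 (volume : Measure R3)) :
    componentMul l k f g =ᵐ[volume] fun x => f x l * g x k :=
  ContinuousLinearMap.coeFn_holder (r := 1) _ f g

theorem continuous_componentMul (l k : Fin 3) :
    Continuous fun q : Lp C3 2 (volume : Measure R3) × Lp C3 2 (volume : Measure R3) =>
      componentMul l k q.1 q.2 :=
  ((componentMul l k).continuous.comp continuous_fst).clm_apply continuous_snd

theorem aestronglyMeasurable_integral_term {α : Type*} [MeasurableSpace α] {μ : Measure α}
    (hν : 0 ≤ ν) (Φ : LPCutoff) {σ : α → ℝ} {u v : α → ZDual} (hσ : AEStronglyMeasurable σ μ)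
    (hu : ∀ m, AEStronglyMeasurable (fun a => l2Rep (Φ.delta m (u a))) μ)
    (hv : ∀ m, AEStronglyMeasurable (fun a => l2Rep (Φ.delta m (v a))) μ) (p : ℤ × ℤ) :
    AEStronglyMeasurable (fun a => ∫ x, IsDyadicFamily.term
      (duhamelSpectrum ν Ω (max (σ a) 0) i l k ψ) (fun m => blockSpectrum Φ m (u a) l)
      (fun m => blockSpectrum Φ m (v a) k) p x) μ := by
  have h1 : AEStronglyMeasurable (fun a => componentMul l k
      (l2Rep (Φ.delta p.1 (u a))) (l2Rep (Φ.delta p.2 (v a)))) μ :=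
    (continuous_componentMul l k).comp_aestronglyMeasurable
      (f := fun a => (l2Rep (Φ.delta p.1 (u a)), l2Rep (Φ.delta p.2 (v a))))
      ((hu p.1).prodMk (hv p.2))
  have h2 := (continuous_integral_fourierInv_duhamelSpectrum_mul Ω i l k ψ
    hν).comp_aestronglyMeasurable (hσ.prodMk h1)
  refine h2.congr (Filter.Eventually.of_forall fun a => integral_congr_ae ?_)
  filter_upwards [componentMul_ae_eq l k (l2Rep (Φ.delta p.1 (u a)))
    (l2Rep (Φ.delta p.2 (v a))), l2Rep_delta_apply_ae_eq Φ p.1 (u a) l,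
    l2Rep_delta_apply_ae_eq Φ p.2 (v a) k] with x e1 e2 e3
  simp only [e1, IsDyadicFamily.term]
  rw [← e2, ← e3]

/-- The component of the pairing `⟨𝒢(s) ℙ ∇·(f ⊗ g), ψ⟩` with indices `i, l, k`. -/
def duhamelPairing (Φ : LPCutoff) (ν Ω s : ℝ) (i l k : Fin 3) (ψ : 𝓢(R3, ℂ)) (f g : ZDual) : ℂ :=
  ∫ x, transposedMultiplier (duhamelSymbol ν Ω s i l k) ψ x *
    (realization Φ f x l * realization Φ g x k)

variable {Φ : LPCutoff} {A B : ℝ} {f g : ZDual}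

section

variable (hν : 0 ≤ ν) {s : ℝ} (hs : 0 ≤ s) (hA : 0 ≤ A) (hB : 0 ≤ B)
  (hf : besovNorm Φ (1 / 2) f ≤ ENNReal.ofReal A) (hg : besovNorm Φ (1 / 2) g ≤ ENNReal.ofReal B)

include hν hs hA hB hf hg

theorem duhamelPairing_integrable_hasSum :
    Integrable (fun x => transposedMultiplier (duhamelSymbol ν Ω s i l k) ψ x *
      (realization Φ f x l * realization Φ g x k)) ∧
    HasSum (fun p => ∫ x, IsDyadicFamily.term (duhamelSpectrum ν Ω s i l k ψ)
      (fun m => blockSpectrum Φ m f l) (fun m => blockSpectrum Φ m g k) p x)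
      (duhamelPairing Φ ν Ω s i l k ψ f g) :=
  (isDyadicFamily_blockSpectrum (l2Norm_delta_lt_top hf) l).integrable_trilinear
    (isDyadicFamily_blockSpectrum (l2Norm_delta_lt_top hg) k)
    (integrable_duhamelSpectrum Ω i l k ψ hν hs) (memLp_duhamelSpectrum Ω i l k ψ hν hs 2) hA hB
    (toReal_l2Norm_delta_le hA hf) (toReal_l2Norm_delta_le hB hg)
    (realization_apply_ae_eq hA hf l) (realization_apply_ae_eq hB hg k)

theorem norm_duhamelPairing_le :
    ‖duhamelPairing Φ ν Ω s i l k ψ f g‖ ≤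
      (12 * (eLpNorm (freqMul l ψ) 1 volume).toReal +
        12 * (eLpNorm (freqMul l ψ) 2 volume).toReal * bernsteinConst) *
        A * B * dyadicSum ^ 2 := by
  have h : ∀ p : ℝ≥0∞, eLpNorm (duhamelSpectrum ν Ω s i l k ψ) p volume ≤
      ENNReal.ofReal (12 * (eLpNorm (freqMul l ψ) p volume).toReal) := fun p => by
    rw [ENNReal.ofReal_mul (by norm_num), ENNReal.ofReal_toReal ((freqMul l ψ).memLp p volume).2.ne]
    simpa using eLpNorm_duhamelSpectrum_le Ω i l k ψ hν hs p
  exact (isDyadicFamily_blockSpectrum (l2Norm_delta_lt_top hf) l).norm_trilinear_le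
    (isDyadicFamily_blockSpectrum (l2Norm_delta_lt_top hg) k)
    (integrable_duhamelSpectrum Ω i l k ψ hν hs) (memLp_duhamelSpectrum Ω i l k ψ hν hs 2)
    (by positivity) (by positivity) (h 1) (h 2) hA hB
    (toReal_l2Norm_delta_le hA hf) (toReal_l2Norm_delta_le hB hg)
    (realization_apply_ae_eq hA hf l) (realization_apply_ae_eq hB hg k)

theorem duhamelPairing_add (χ : 𝓢(R3, ℂ)) :
    duhamelPairing Φ ν Ω s i l k (ψ + χ) f g
      = duhamelPairing Φ ν Ω s i l k ψ f g + duhamelPairing Φ ν Ω s i l k χ f g := by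
  have h1 := (duhamelPairing_integrable_hasSum Ω i l k ψ hν hs hA hB hf hg).1
  have h2 := (duhamelPairing_integrable_hasSum Ω i l k χ hν hs hA hB hf hg).1
  rw [duhamelPairing, duhamelPairing, duhamelPairing, ← integral_add h1 h2]
  refine integral_congr_ae (Filter.Eventually.of_forall fun x => ?_)
  have e : transposedMultiplier (duhamelSymbol ν Ω s i l k) (ψ + χ) x
      = transposedMultiplier (duhamelSymbol ν Ω s i l k) ψ x
        + transposedMultiplier (duhamelSymbol ν Ω s i l k) χ x := by
    have h := fun θ => (Real.fourierIntegral_convergent_iff (μ := volume)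
      (f := duhamelSpectrum ν Ω s i l k θ) (-x)).2 (integrable_duhamelSpectrum Ω i l k θ hν hs)
    simp only [inner_neg_right, neg_neg] at h
    rw [transposedMultiplier_eq, transposedMultiplier_eq, transposedMultiplier_eq,
      duhamelSpectrum_add, Real.fourierInv_eq, Real.fourierInv_eq, Real.fourierInv_eq,
      ← integral_add (h ψ) (h χ)]
    simp
  simp only [e, add_mul]

/-- The bilinear estimate for the dyadic blocks of the integrand in Duhamel's formula. -/
theorem norm_duhamelPairing_deltaS_le {M : ℝ} (hM0 : 0 ≤ M) (hM : ∀ j ξ, ‖Φ.symbol j ξ‖ ≤ M)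
    {j : ℤ} {W : ℝ} (hW : 0 ≤ W) (hgW : ∀ m : ℤ, (l2Norm (Φ.delta m g)).toReal ≤
      W * (2 : ℝ) ^ (-(m : ℝ) / 2 + max ((j : ℝ) - m) 0 / 2)) :
    ‖duhamelPairing Φ ν Ω s i l k (Φ.deltaS j ψ) f g‖ ≤
      10 * bernsteinConst * dyadicSum ^ 2 * A * W * (2 : ℝ) ^ ((j : ℝ) / 2) *
      (32 * M * (2 : ℝ) ^ j * Real.exp (-(9 / 16 * ν * (2 : ℝ) ^ (2 * j) * s)) *
        (eLpNorm ψ 2 volume).toReal) := by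
  have h : eLpNorm (duhamelSpectrum ν Ω s i l k (Φ.deltaS j ψ)) 2 volume ≤
      ENNReal.ofReal (32 * M * (2 : ℝ) ^ j * Real.exp (-(9 / 16 * ν * (2 : ℝ) ^ (2 * j) * s)) *
        (eLpNorm ψ 2 volume).toReal) := by
    rw [ENNReal.ofReal_mul (by positivity), ENNReal.ofReal_toReal (ψ.memLp 2 volume).2.ne]
    exact eLpNorm_duhamelSpectrum_deltaS_le hM0 hM hν Ω hs i l k j ψ
  exact (isDyadicFamily_blockSpectrum (l2Norm_delta_lt_top hf) l).norm_trilinear_localized_le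
    (isDyadicFamily_blockSpectrum (l2Norm_delta_lt_top hg) k)
    (memLp_duhamelSpectrum Ω i l k _ hν hs 2)
    (duhamelSpectrum_deltaS_mem_annulus Φ ν Ω s i l k j ψ) (by positivity) h hA hB
    (toReal_l2Norm_delta_le hA hf) (toReal_l2Norm_delta_le hB hg) hW hgW
    (realization_apply_ae_eq hA hf l) (realization_apply_ae_eq hB hg k)

end

theorem duhamelPairing_smul (ν s : ℝ) (f g : ZDual) (a : ℂ) :
    duhamelPairing Φ ν Ω s i l k (a • ψ) f g = a * duhamelPairing Φ ν Ω s i l k ψ f g := by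
  rw [duhamelPairing, duhamelPairing, ← integral_const_mul]
  refine integral_congr_ae (Filter.Eventually.of_forall fun x => ?_)
  have e : transposedMultiplier (duhamelSymbol ν Ω s i l k) (a • ψ) x
      = a * transposedMultiplier (duhamelSymbol ν Ω s i l k) ψ x := by
    rw [transposedMultiplier_eq, transposedMultiplier_eq, duhamelSpectrum_smul,
      Real.fourierInv_eq, Real.fourierInv_eq, ← integral_const_mul]
    refine integral_congr_ae (Filter.Eventually.of_forall fun ξ => ?_)
    simp only [Pi.smul_apply, Circle.smul_def, smul_eq_mul]
    ring
  simp only [e, mul_assoc]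

/-- The pairing is the almost everywhere limit of finite partial sums of the block expansion, each
measurable by `aestronglyMeasurable_integral_term`. -/
theorem aestronglyMeasurable_duhamelPairing {α : Type*} [MeasurableSpace α] {μ : Measure α}
    (hν : 0 ≤ ν) {σ : α → ℝ} {u v : α → ZDual} (hσ : AEStronglyMeasurable σ μ)
    (hu : ∀ m, AEStronglyMeasurable (fun a => l2Rep (Φ.delta m (u a))) μ)
    (hv : ∀ m, AEStronglyMeasurable (fun a => l2Rep (Φ.delta m (v a))) μ)
    (hA : 0 ≤ A) (hB : 0 ≤ B) (huA : ∀ᵐ a ∂μ, besovNorm Φ (1 / 2) (u a) ≤ ENNReal.ofReal A)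
    (hvB : ∀ᵐ a ∂μ, besovNorm Φ (1 / 2) (v a) ≤ ENNReal.ofReal B) :
    AEStronglyMeasurable
      (fun a => duhamelPairing Φ ν Ω (max (σ a) 0) i l k ψ (u a) (v a)) μ := by
  refine aestronglyMeasurable_of_tendsto_ae (Filter.atTop : Filter (Finset (ℤ × ℤ)))
    (f := fun S a => ∑ p ∈ S, ∫ x, IsDyadicFamily.term
      (duhamelSpectrum ν Ω (max (σ a) 0) i l k ψ) (fun m => blockSpectrum Φ m (u a) l)
      (fun m => blockSpectrum Φ m (v a) k) p x)
    (fun S => Finset.aestronglyMeasurable_fun_sum S fun p _ =>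
      aestronglyMeasurable_integral_term Ω i l k ψ hν Φ hσ hu hv p) ?_
  filter_upwards [huA, hvB] with a ha hb
  exact (duhamelPairing_integrable_hasSum Ω i l k ψ hν (le_max_right _ _) hA hB ha hb).2

end Pairing

/-! ### The vector-valued pairing -/

/-- The pairing `⟨𝒢(s) ℙ ∇·(f ⊗ g), ψ⟩`. -/
def duhamelForm (Φ : LPCutoff) (ν Ω s : ℝ) (ψ : 𝓢(R3, ℂ)) (f g : ZDual) : C3 :=
  ∫ x, duhamelIntegrand ν Ω s (realization Φ f) (realization Φ g) ψ x

theorem C3.norm_le_sum (w : C3) : ‖w‖ ≤ ∑ i, ‖w i‖ := by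
  have e : w = ∑ i, EuclideanSpace.single i (w i) := by
    ext j
    simp [Fin.sum_univ_three]
    fin_cases j <;> simp
  calc ‖w‖ = ‖∑ i, EuclideanSpace.single i (w i)‖ := by rw [← e]
    _ ≤ ∑ i, ‖EuclideanSpace.single i (w i)‖ := norm_sum_le _ _
    _ = _ := Finset.sum_congr rfl fun i _ => PiLp.norm_single _ _ _ _

section Form

variable {ν : ℝ} (Ω : ℝ) (ψ : 𝓢(R3, ℂ)) {Φ : LPCutoff} {A B : ℝ} {f g : ZDual} {s : ℝ}
  (hν : 0 ≤ ν) (hs : 0 ≤ s) (hA : 0 ≤ A) (hB : 0 ≤ B)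
  (hf : besovNorm Φ (1 / 2) f ≤ ENNReal.ofReal A) (hg : besovNorm Φ (1 / 2) g ≤ ENNReal.ofReal B)

include hν hs hA hB hf hg

theorem integrable_duhamelIntegrand_apply (i : Fin 3) :
    Integrable (fun x =>
      duhamelIntegrand ν Ω s (realization Φ f) (realization Φ g) ψ x i) := by
  simp only [duhamelIntegrand]
  exact integrable_finsetSum _ fun l _ => integrable_finsetSum _ fun k _ =>
    (duhamelPairing_integrable_hasSum Ω i l k ψ hν hs hA hB hf hg).1

theorem integrable_duhamelIntegrand :
    Integrable (duhamelIntegrand ν Ω s (realization Φ f) (realization Φ g) ψ) :=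
  Integrable.of_eval_piLp (integrable_duhamelIntegrand_apply Ω ψ hν hs hA hB hf hg)

theorem duhamelForm_apply (i : Fin 3) :
    duhamelForm Φ ν Ω s ψ f g i = ∑ l, ∑ k, duhamelPairing Φ ν Ω s i l k ψ f g := by
  have h := fun i l k => (duhamelPairing_integrable_hasSum Ω i l k ψ hν hs hA hB hf hg).1
  rw [duhamelForm, eval_integral_piLp
    (integrable_duhamelIntegrand_apply Ω ψ hν hs hA hB hf hg)]
  simp only [duhamelIntegrand]
  rw [integral_finsetSum _ fun l _ => integrable_finsetSum _ fun k _ => h i l k]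
  refine Finset.sum_congr rfl fun l _ => ?_
  rw [integral_finsetSum _ fun k _ => h i l k]
  rfl

theorem duhamelForm_add (χ : 𝓢(R3, ℂ)) :
    duhamelForm Φ ν Ω s (ψ + χ) f g
      = duhamelForm Φ ν Ω s ψ f g + duhamelForm Φ ν Ω s χ f g := by
  ext i
  rw [PiLp.add_apply]
  simp only [duhamelForm_apply Ω _ hν hs hA hB hf hg,
    duhamelPairing_add Ω _ _ _ _ hν hs hA hB hf hg, Finset.sum_add_distrib]

theorem duhamelForm_smul (a : ℂ) :
    duhamelForm Φ ν Ω s (a • ψ) f g = a • duhamelForm Φ ν Ω s ψ f g := by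
  ext i
  rw [PiLp.smul_apply]
  simp only [duhamelForm_apply Ω _ hν hs hA hB hf hg, duhamelPairing_smul, Finset.mul_sum,
    smul_eq_mul]

theorem norm_duhamelForm_le_sum :
    ‖duhamelForm Φ ν Ω s ψ f g‖ ≤ ∑ i, ∑ l, ∑ k, ‖duhamelPairing Φ ν Ω s i l k ψ f g‖ := by
  refine (C3.norm_le_sum _).trans (Finset.sum_le_sum fun i _ => ?_)
  rw [duhamelForm_apply Ω ψ hν hs hA hB hf hg]
  exact (norm_sum_le _ _).trans (Finset.sum_le_sum fun l _ => norm_sum_le _ _)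

theorem norm_duhamelForm_le :
    ‖duhamelForm Φ ν Ω s ψ f g‖ ≤ (∑ _i : Fin 3, ∑ l : Fin 3, ∑ _k : Fin 3,
      (12 * (eLpNorm (freqMul l ψ) 1 volume).toReal +
        12 * (eLpNorm (freqMul l ψ) 2 volume).toReal * bernsteinConst)) *
        (A * B * dyadicSum ^ 2) := by
  refine (norm_duhamelForm_le_sum Ω ψ hν hs hA hB hf hg).trans ?_
  simp only [Finset.sum_mul]
  refine Finset.sum_le_sum fun i _ => Finset.sum_le_sum fun l _ => Finset.sum_le_sum fun k _ => ?_
  refine (norm_duhamelPairing_le Ω i l k ψ hν hs hA hB hf hg).trans (le_of_eq ?_)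
  ring

theorem norm_duhamelForm_deltaS_le {M : ℝ} (hM0 : 0 ≤ M) (hM : ∀ j ξ, ‖Φ.symbol j ξ‖ ≤ M)
    {j : ℤ} {W : ℝ} (hW : 0 ≤ W) (hgW : ∀ m : ℤ, (l2Norm (Φ.delta m g)).toReal ≤
      W * (2 : ℝ) ^ (-(m : ℝ) / 2 + max ((j : ℝ) - m) 0 / 2)) :
    ‖duhamelForm Φ ν Ω s (Φ.deltaS j ψ) f g‖ ≤
      8640 * bernsteinConst * dyadicSum ^ 2 * M * A * W * (eLpNorm ψ 2 volume).toReal *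
      ((2 : ℝ) ^ ((j : ℝ) / 2) * (2 : ℝ) ^ j) *
        Real.exp (-(9 / 16 * ν * (2 : ℝ) ^ (2 * j) * s)) := by
  refine (norm_duhamelForm_le_sum Ω _ hν hs hA hB hf hg).trans ?_
  refine (Finset.sum_le_sum fun i _ => Finset.sum_le_sum fun l _ => Finset.sum_le_sum fun k _ =>
    norm_duhamelPairing_deltaS_le Ω i l k ψ hν hs hA hB hf hg hM0 hM hW hgW).trans (le_of_eq ?_)
  -- There are `27` index triples, and `27 · 10 · 32 = 8640`.
  simp only [Finset.sum_const, Finset.card_univ, Fintype.card_fin, nsmul_eq_mul]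
  push_cast
  ring

end Form

theorem aestronglyMeasurable_duhamelForm {α : Type*} [MeasurableSpace α] {μ : Measure α} {ν : ℝ}
    (Ω : ℝ) (ψ : 𝓢(R3, ℂ)) {Φ : LPCutoff} {A B : ℝ}
    (hν : 0 ≤ ν) {σ : α → ℝ} {u v : α → ZDual} (hσ : AEStronglyMeasurable σ μ)
    (hu : ∀ m, AEStronglyMeasurable (fun a => l2Rep (Φ.delta m (u a))) μ)
    (hv : ∀ m, AEStronglyMeasurable (fun a => l2Rep (Φ.delta m (v a))) μ)
    (hA : 0 ≤ A) (hB : 0 ≤ B) (huA : ∀ᵐ a ∂μ, besovNorm Φ (1 / 2) (u a) ≤ ENNReal.ofReal A)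
    (hvB : ∀ᵐ a ∂μ, besovNorm Φ (1 / 2) (v a) ≤ ENNReal.ofReal B) :
    AEStronglyMeasurable (fun a => duhamelForm Φ ν Ω (max (σ a) 0) ψ (u a) (v a)) μ := by
  have h : AEStronglyMeasurable (fun a => ∑ i, (∑ l, ∑ k,
      duhamelPairing Φ ν Ω (max (σ a) 0) i l k ψ (u a) (v a)) •
        (EuclideanSpace.single i (1 : ℂ) : C3)) μ :=
    Finset.aestronglyMeasurable_fun_sum _ fun i _ =>
      (Finset.aestronglyMeasurable_fun_sum _ fun l _ =>
        Finset.aestronglyMeasurable_fun_sum _ fun k _ =>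
          aestronglyMeasurable_duhamelPairing Ω i l k ψ hν hσ hu hv hA hB huA hvB).smul_const _
  refine h.congr ?_
  filter_upwards [huA, hvB] with a ha hb
  ext j
  rw [duhamelForm_apply Ω ψ hν (le_max_right _ _) hA hB ha hb]
  simp [Fin.sum_univ_three]
  fin_cases j <;> simp

/-! ### Distributions bounded in `L²` -/

theorem norm_toLp_two (ψ : 𝓢(R3, ℂ)) : ‖ψ.toLp 2‖ = (eLpNorm ψ 2 volume).toReal := by
  rw [Lp.norm_def, eLpNorm_congr_ae (ψ.coeFn_toLp 2 volume)]

/-- The bound extends `ℓ` from the dense Schwartz functions to `L²`, and Riesz represents the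
extension. The conjugate is there because the inner product is antilinear in the representing
vector. -/
theorem exists_L2_of_bound (ℓ : 𝓢(R3, ℂ) →ₗ[ℂ] ℂ) {m : ℝ} (hm : 0 ≤ m)
    (h : ∀ ψ : 𝓢(R3, ℂ), ‖ℓ ψ‖ ≤ m * (eLpNorm ψ 2 volume).toReal) :
    ∃ g : Lp ℂ 2 (volume : Measure R3), ‖g‖ ≤ m ∧
      ∀ ψ : 𝓢(R3, ℂ), ℓ ψ = ∫ x, ψ x * (starRingEnd ℂ) (g x) := by
  set e : 𝓢(R3, ℂ) →ₗ[ℂ] Lp ℂ 2 (volume : Measure R3) :=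
    (SchwartzMap.toLpCLM ℂ (E := R3) ℂ 2 volume).toLinearMap with he
  have hd : DenseRange e := SchwartzMap.denseRange_toLpCLM ENNReal.ofNat_ne_top
  have hb : ∀ ψ, ‖ℓ ψ‖ ≤ m * ‖e ψ‖ := fun ψ => by
    have : ‖e ψ‖ = (eLpNorm ψ 2 volume).toReal := norm_toLp_two ψ
    rw [this]; exact h ψ
  set L := ℓ.extendOfNorm e with hL
  refine ⟨(InnerProductSpace.toDual ℂ _).symm L, ?_, fun ψ => ?_⟩
  · rw [LinearIsometryEquiv.norm_map]
    exact ContinuousLinearMap.opNorm_le_bound _ hm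
      (LinearMap.norm_extendOfNorm_apply_le hd m hb)
  · rw [← LinearMap.extendOfNorm_eq hd ⟨m, hb⟩ ψ, ← hL, ← InnerProductSpace.toDual_symm_apply,
      L2.inner_def]
    refine integral_congr_ae ?_
    filter_upwards [ψ.coeFn_toLp 2 volume] with x hx
    rw [RCLike.inner_apply]
    congr 1

theorem l2Norm_le_of_bound (D : 𝓢'(R3, C3)) {m : ℝ} (hm : 0 ≤ m)
    (h : ∀ ψ : 𝓢(R3, ℂ), ‖D ψ‖ ≤ m * (eLpNorm ψ 2 volume).toReal) :
    l2Norm D ≤ ENNReal.ofReal (3 * m) := by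
  have hex : ∀ i : Fin 3, ∃ g : Lp ℂ 2 (volume : Measure R3), ‖g‖ ≤ m ∧
      ∀ ψ : 𝓢(R3, ℂ), D ψ i = ∫ x, ψ x * (starRingEnd ℂ) (g x) := fun i =>
    exists_L2_of_bound ((EuclideanSpace.proj i : C3 →L[ℂ] ℂ).toLinearMap ∘ₗ D.toLinearMap) hm
      fun ψ => (PiLp.norm_apply_le _ i).trans (h ψ)
  choose g hgn hg using hex
  -- These maps undo the conjugates and assemble the three components; conjugation makes them only
  -- real-linear.
  set T : Fin 3 → ℂ →L[ℝ] C3 := fun i =>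
    LinearMap.mkContinuous
      { toFun := fun z => EuclideanSpace.single i ((starRingEnd ℂ) z)
        map_add' := fun z w => by ext j; by_cases hj : j = i <;> simp [hj]
        map_smul' := fun r z => by ext j; by_cases hj : j = i <;> simp [hj] } 1
      (fun z => by simp) with hT
  have hTa : ∀ i z, T i z = EuclideanSpace.single i ((starRingEnd ℂ) z) := fun _ _ => rfl
  have hTn : ∀ i, ‖T i‖ ≤ 1 := fun i => LinearMap.mkContinuous_norm_le _ zero_le_one _
  set G : Lp C3 2 (volume : Measure R3) := ∑ i, (T i).compLp (g i) with hG
  have hGn : ‖G‖ ≤ 3 * m := by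
    refine (norm_sum_le _ _).trans ((Finset.sum_le_sum (g := fun _ => m) fun i _ => ?_).trans
      (by simp))
    refine ((T i).norm_compLp_le (g i)).trans ?_
    calc ‖T i‖ * ‖g i‖ ≤ 1 * m := mul_le_mul (hTn i) (hgn i) (norm_nonneg _) zero_le_one
      _ = m := one_mul m
  have hGx : ∀ᵐ x, ∀ i, G x i = (starRingEnd ℂ) (g i x) := by
    have h1 := ae_all_iff.mpr fun i => (T i).coeFn_compLp (g i)
    have h2 : G =ᵐ[volume] fun x => ∑ i, ((T i).compLp (g i) : R3 → C3) x := by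
      have h3 := Lp.coeFn_add ((T 0).compLp (g 0) + (T 1).compLp (g 1)) ((T 2).compLp (g 2))
      have h4 := Lp.coeFn_add ((T 0).compLp (g 0)) ((T 1).compLp (g 1))
      rw [hG, Fin.sum_univ_three]
      filter_upwards [h3, h4] with x e3 e4
      rw [e3, Pi.add_apply, e4, Pi.add_apply, Fin.sum_univ_three]
    filter_upwards [h1, h2] with x e1 e2 i
    rw [e2]
    simp only [e1, hTa]
    simp [Fin.sum_univ_three]
    fin_cases i <;> simp
  have hGD : (G : 𝓢'(R3, C3)) = D := by
    ext ψ i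
    rw [Lp.toTemperedDistribution_apply, hg i ψ]
    have hint : Integrable fun x => ψ x • G x :=
      memLp_one_iff_integrable.mp ((Lp.memLp G).smul (ψ.memLp 2 volume))
    refine ((EuclideanSpace.proj i : C3 →L[ℂ] ℂ).integral_comp_comm hint).symm.trans ?_
    refine integral_congr_ae ?_
    filter_upwards [hGx] with x hx
    simp [hx i]
  refine (iInf₂_le (f := fun (g : Lp C3 2 (volume : Measure R3)) (_ : (g : 𝓢'(R3, C3)) = D) =>
    ‖g‖ₑ) G hGD).trans ?_
  rw [← ofReal_norm]
  exact ENNReal.ofReal_le_ofReal hGn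

/-! ### The weights -/

section Weights

variable {c T : ℝ}

theorem eWeight_pos (hc : 0 < c) (hT : 0 < T) (k : ℤ) : 0 < eWeight c T k := by
  have h : 0 < c * (2 : ℝ) ^ (2 * k) * T := by positivity
  rw [eWeight, sub_pos, Real.exp_lt_one_iff]
  linarith

theorem eWeight_le_one (k : ℤ) : eWeight c T k ≤ 1 := by
  rw [eWeight]
  linarith [Real.exp_pos (-c * (2 : ℝ) ^ (2 * k) * T)]

theorem eWeight_mono (hc : 0 < c) (hT : 0 < T) : Monotone (eWeight c T) := fun j k hjk => by
  have h : (2 : ℝ) ^ (2 * j) ≤ (2 : ℝ) ^ (2 * k) := zpow_le_zpow_right₀ (by norm_num) (by lia)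
  have h2 : c * (2 : ℝ) ^ (2 * j) * T ≤ c * (2 : ℝ) ^ (2 * k) * T := by gcongr
  rw [eWeight, eWeight]
  have := Real.exp_le_exp.mpr (show -c * (2 : ℝ) ^ (2 * k) * T ≤ -c * (2 : ℝ) ^ (2 * j) * T by
    linarith)
  linarith

theorem omegaWeight_term_le_one (j : ℤ) (k : Set.Ici j) :
    eWeight c T k * (2 : ℝ) ^ (((j : ℝ) - ((k : ℤ) : ℝ)) / 2) ≤ 1 := by
  have hk : (j : ℝ) ≤ ((k : ℤ) : ℝ) := by exact_mod_cast k.2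
  refine mul_le_one₀ (eWeight_le_one _) (by positivity) ?_
  exact Real.rpow_le_one_of_one_le_of_nonpos (by norm_num) (by linarith)

theorem bddAbove_omegaWeight (j : ℤ) : BddAbove (Set.range fun k : Set.Ici j =>
    eWeight c T k * (2 : ℝ) ^ (((j : ℝ) - ((k : ℤ) : ℝ)) / 2)) :=
  ⟨1, by rintro _ ⟨k, rfl⟩; exact omegaWeight_term_le_one j k⟩

theorem omegaWeight_le_one (j : ℤ) : omegaWeight c T j ≤ 1 :=
  haveI : Nonempty (Set.Ici j) := ⟨⟨j, Set.self_mem_Ici⟩⟩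
  ciSup_le (omegaWeight_term_le_one j)

/-- For `m ≤ j` the index `k = j` is admissible in the supremum for `ω_m`; for `j ≤ m` take `k = m`
and use that `e` is increasing. This is the only property of the weights that the estimate exploits
besides `ω ≤ 1` and positivity. -/
theorem eWeight_mul_le_omegaWeight (hc : 0 < c) (hT : 0 < T) (j m : ℤ) :
    eWeight c T j * (2 : ℝ) ^ (-(max ((j : ℝ) - m) 0 / 2)) ≤ omegaWeight c T m := by
  rcases le_total m j with h | h
  · have h' : (m : ℝ) ≤ j := by exact_mod_cast h
    refine le_trans (le_of_eq ?_) (le_ciSup (bddAbove_omegaWeight m) ⟨j, h⟩)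
    rw [max_eq_left (by linarith)]
    congr 2
    ring
  · have h' : (j : ℝ) ≤ m := by exact_mod_cast h
    refine le_trans ?_ (le_ciSup (bddAbove_omegaWeight m) ⟨m, Set.self_mem_Ici⟩)
    rw [max_eq_right (by linarith)]
    simpa using eWeight_mono hc hT h

theorem omegaWeight_pos (hc : 0 < c) (hT : 0 < T) (m : ℤ) : 0 < omegaWeight c T m :=
  lt_of_lt_of_le (mul_pos (eWeight_pos hc hT m) (by positivity))
    (eWeight_mul_le_omegaWeight hc hT m m)

/-- Monotonicity if `κ ≤ 1`, Bernoulli's inequality for `(1 + s)^κ` with `s = e^{-y} - 1` if `κ ≥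
1`. It exchanges the heat rate `9ν/16` for the arbitrary rate `c` of the weights. -/
theorem one_sub_exp_mul_le {κ y : ℝ} (hy : 0 ≤ y) :
    1 - Real.exp (-(κ * y)) ≤ max 1 κ * (1 - Real.exp (-y)) := by
  have h0 : 0 ≤ 1 - Real.exp (-y) := by
    rw [sub_nonneg, Real.exp_le_one_iff]; linarith
  rcases le_total κ 1 with h | h
  · rw [max_eq_left h, one_mul]
    have : Real.exp (-y) ≤ Real.exp (-(κ * y)) := by
      refine Real.exp_le_exp.mpr ?_
      nlinarith
    linarith
  · rw [max_eq_right h]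
    have h1 := one_add_mul_self_le_rpow_one_add (s := Real.exp (-y) - 1)
      (by linarith [Real.exp_pos (-y)]) h
    rw [add_sub_cancel, ← Real.exp_mul] at h1
    have e : -y * κ = -(κ * y) := by ring
    rw [e] at h1
    linarith

/-- Besides the parabolic gain `2^{-2j}`, the finite time interval yields a factor `e_{j,T}`, which
pays for the division by `e_{j,T}` in `ae_l2Norm_delta_le_weighted`. -/
theorem integral_exp_le {ν t : ℝ} (hν : 0 < ν) (hc : 0 < c) (ht : 0 ≤ t) (htT : t ≤ T) (j : ℤ) :
    ∫ τ in Set.Ioo 0 t, Real.exp (-(9 / 16 * ν * (2 : ℝ) ^ (2 * j) * (t - τ))) ≤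
      max 1 (9 / 16 * ν / c) / (9 / 16 * ν) * ((2 : ℝ) ^ (2 * j))⁻¹ * eWeight c T j := by
  set a : ℝ := 9 / 16 * ν * (2 : ℝ) ^ (2 * j) with ha
  have ha0 : 0 < a := by positivity
  have hT0 : 0 ≤ T := ht.trans htT
  have e1 : ∫ τ in Set.Ioo 0 t, Real.exp (-(a * (t - τ))) = (1 - Real.exp (-(a * t))) / a := by
    rw [← integral_Ioc_eq_integral_Ioo, ← intervalIntegral.integral_of_le ht]
    have hd : ∀ τ ∈ Set.uIcc 0 t, HasDerivAt (fun τ => Real.exp (-(a * (t - τ))) / a)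
        (Real.exp (-(a * (t - τ)))) τ := fun τ _ => by
      have h1 : HasDerivAt (fun τ => -(a * (t - τ))) a τ := by
        have h0 : HasDerivAt (fun τ => -(a * (t - τ))) (-(a * -1)) τ :=
          (((hasDerivAt_id τ).const_sub t).const_mul a).neg
        rwa [mul_neg_one, neg_neg] at h0
      have h2 := h1.exp.div_const a
      rwa [mul_div_cancel_right₀ _ ha0.ne'] at h2
    rw [intervalIntegral.integral_eq_sub_of_hasDerivAt hd
      (Continuous.intervalIntegrable (by fun_prop) _ _)]
    simp
    ring
  rw [e1]
  have h2 : 1 - Real.exp (-(a * t)) ≤ max 1 (9 / 16 * ν / c) * eWeight c T j := by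
    have h3 := one_sub_exp_mul_le (κ := 9 / 16 * ν / c) (y := c * (2 : ℝ) ^ (2 * j) * T)
      (by positivity)
    have e2 : 9 / 16 * ν / c * (c * (2 : ℝ) ^ (2 * j) * T) = a * T := by
      rw [ha]; field_simp
    have e3 : eWeight c T j = 1 - Real.exp (-(c * (2 : ℝ) ^ (2 * j) * T)) := by
      rw [eWeight]; congr 2; ring
    rw [e2, ← e3] at h3
    refine le_trans ?_ h3
    have : Real.exp (-(a * T)) ≤ Real.exp (-(a * t)) := by
      refine Real.exp_le_exp.mpr ?_
      nlinarith
    linarith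
  calc (1 - Real.exp (-(a * t))) / a ≤ max 1 (9 / 16 * ν / c) * eWeight c T j / a := by gcongr
    _ = _ := by rw [ha]; field_simp

end Weights

/-! ### Time-dependent bounds -/

section Bounds

variable {Φ : LPCutoff} {T c : ℝ} {v : ℝ → ZDual}

theorem ae_besovNorm_le (h : linftyBesovNorm Φ (1 / 2) T v < ∞) :
    ∀ᵐ τ ∂(volume.restrict (Set.Ioo 0 T)),
      besovNorm Φ (1 / 2) (v τ) ≤ ENNReal.ofReal (linftyBesovNorm Φ (1 / 2) T v).toReal := by
  rw [ENNReal.ofReal_toReal h.ne]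
  exact ENNReal.ae_le_essSup _

/-- This makes the weighted norm finite, so that it can be handled as a real number. -/
theorem weightedNorm_le : weightedNorm Φ c T v ≤ linftyBesovNorm Φ (1 / 2) T v := by
  refine iSup_le fun j => ?_
  have h1 : ENNReal.ofReal (omegaWeight c T j) ≤ 1 :=
    (ENNReal.ofReal_le_ofReal (omegaWeight_le_one j)).trans_eq ENNReal.ofReal_one
  calc ENNReal.ofReal (omegaWeight c T j) * (2 : ℝ≥0∞) ^ ((j : ℝ) / 2) *
        essSup (fun t => l2Norm (Φ.delta j (v t))) (volume.restrict (Set.Ioo 0 T))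
      ≤ 1 * (2 : ℝ≥0∞) ^ ((j : ℝ) / 2) *
        essSup (fun t => l2Norm (Φ.delta j (v t))) (volume.restrict (Set.Ioo 0 T)) := by gcongr
    _ = essSup (fun t => (2 : ℝ≥0∞) ^ ((j : ℝ) / 2) * l2Norm (Φ.delta j (v t)))
          (volume.restrict (Set.Ioo 0 T)) := by
        rw [one_mul, ← ENNReal.essSup_const_mul]
    _ ≤ linftyBesovNorm Φ (1 / 2) T v := by
        refine essSup_mono_ae (Filter.Eventually.of_forall fun t => ?_)
        have := le_iSup (fun j : ℤ => (2 : ℝ≥0∞) ^ ((j : ℝ) * (1 / 2)) *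
          l2Norm (Φ.delta j (v t))) j
        simpa [besovNorm, div_eq_mul_inv] using this

/-- Here `j` is the output frequency: `ω_m` is replaced by its lower bound in terms of `e_j`, which
is positive. The exceptional times do not depend on `j` or `m`, as there are only countably many
blocks. -/
theorem ae_l2Norm_delta_le_weighted (hc : 0 < c) (hT : 0 < T)
    (h : weightedNorm Φ c T v < ∞) :
    ∀ᵐ τ ∂(volume.restrict (Set.Ioo 0 T)), ∀ j m : ℤ, (l2Norm (Φ.delta m (v τ))).toReal ≤
      (weightedNorm Φ c T v).toReal / eWeight c T j *
        (2 : ℝ) ^ (-(m : ℝ) / 2 + max ((j : ℝ) - m) 0 / 2) := by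
  have hae : ∀ᵐ τ ∂(volume.restrict (Set.Ioo 0 T)), ∀ m : ℤ, l2Norm (Φ.delta m (v τ)) ≤
      essSup (fun t => l2Norm (Φ.delta m (v t))) (volume.restrict (Set.Ioo 0 T)) :=
    ae_all_iff.mpr fun m => ENNReal.ae_le_essSup _
  filter_upwards [hae] with τ hτ j m
  set W := (weightedNorm Φ c T v).toReal with hW
  have hω := omegaWeight_pos hc hT m
  have hE := eWeight_pos hc hT j
  have h1 : ENNReal.ofReal (omegaWeight c T m * (2 : ℝ) ^ ((m : ℝ) / 2)) *
      l2Norm (Φ.delta m (v τ)) ≤ ENNReal.ofReal W := by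
    rw [hW, ENNReal.ofReal_toReal h.ne, ENNReal.ofReal_mul hω.le, ← two_rpow_ofReal]
    refine le_trans ?_ (le_iSup (fun j : ℤ => ENNReal.ofReal (omegaWeight c T j) *
      (2 : ℝ≥0∞) ^ ((j : ℝ) / 2) *
      essSup (fun t => l2Norm (Φ.delta j (v t))) (volume.restrict (Set.Ioo 0 T))) m)
    gcongr
    exact hτ m
  have hW0 : 0 ≤ W := ENNReal.toReal_nonneg
  have h2 : omegaWeight c T m * (2 : ℝ) ^ ((m : ℝ) / 2) * (l2Norm (Φ.delta m (v τ))).toReal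
      ≤ W := by
    have := ENNReal.toReal_le_of_le_ofReal hW0 h1
    rwa [ENNReal.toReal_mul, ENNReal.toReal_ofReal (by positivity)] at this
  have h3 := eWeight_mul_le_omegaWeight hc hT j m
  set x := (l2Norm (Φ.delta m (v τ))).toReal with hx
  have hx0 : 0 ≤ x := ENNReal.toReal_nonneg
  have h4 : eWeight c T j * (2 : ℝ) ^ (-(max ((j : ℝ) - m) 0 / 2)) * (2 : ℝ) ^ ((m : ℝ) / 2) * x
      ≤ W := by
    refine le_trans ?_ h2
    gcongr
  have e : (2 : ℝ) ^ (-(m : ℝ) / 2 + max ((j : ℝ) - m) 0 / 2) *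
      ((2 : ℝ) ^ (-(max ((j : ℝ) - m) 0 / 2)) * (2 : ℝ) ^ ((m : ℝ) / 2)) = 1 := by
    rw [← Real.rpow_add (by norm_num), ← Real.rpow_add (by norm_num)]
    have : -(m : ℝ) / 2 + max ((j : ℝ) - m) 0 / 2 + (-(max ((j : ℝ) - m) 0 / 2) + (m : ℝ) / 2)
        = 0 := by ring
    rw [this, Real.rpow_zero]
  rw [div_mul_eq_mul_div, le_div_iff₀ hE]
  calc x * eWeight c T j
      = (2 : ℝ) ^ (-(m : ℝ) / 2 + max ((j : ℝ) - m) 0 / 2) * (eWeight c T j *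
        (2 : ℝ) ^ (-(max ((j : ℝ) - m) 0 / 2)) * (2 : ℝ) ^ ((m : ℝ) / 2) * x) := by
        linear_combination (-(x * eWeight c T j)) * e
    _ ≤ (2 : ℝ) ^ (-(m : ℝ) / 2 + max ((j : ℝ) - m) 0 / 2) * W := by gcongr
    _ = _ := mul_comm _ _

theorem MemLinftyBesov.aestronglyMeasurable_l2Rep (h : MemLinftyBesov Φ (1 / 2) T v) (m : ℤ) :
    AEStronglyMeasurable (fun τ => l2Rep (Φ.delta m (v τ))) (volume.restrict (Set.Ioo 0 T)) := by
  refine aestronglyMeasurable_l2Rep_delta Φ m h.measurable ?_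
  filter_upwards [ae_besovNorm_le h.finite] with τ hτ
  exact l2Norm_delta_lt_top hτ m

end Bounds

/-! ### The bilinear operator -/

section Duhamel

/-- The pairing of `B(u, v)(t)` with `ψ`. -/
def duhamelIntegral (Φ : LPCutoff) (ν Ω : ℝ) (u v : ℝ → ZDual) (t : ℝ) (ψ : 𝓢(R3, ℂ)) : C3 :=
  ∫ τ in Set.Ioo 0 t, duhamelForm Φ ν Ω (t - τ) ψ (u τ) (v τ)

variable {Φ : LPCutoff} {ν : ℝ} (Ω : ℝ) {T : ℝ} {u v : ℝ → ZDual} (hν : 0 < ν)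
  (hu : MemLinftyBesov Φ (1 / 2) T u) (hv : MemLinftyBesov Φ (1 / 2) T v) {t : ℝ}

theorem ae_restrict_Ioo_of_le {p : ℝ → Prop} (htT : t ≤ T)
    (h : ∀ᵐ τ ∂(volume.restrict (Set.Ioo 0 T)), p τ) :
    ∀ᵐ τ ∂(volume.restrict (Set.Ioo 0 t)), p τ :=
  ae_restrict_of_ae_restrict_of_subset (Set.Ioo_subset_Ioo le_rfl htT) h

theorem ae_restrict_Ioo_sub_nonneg (t : ℝ) :
    ∀ᵐ τ ∂(volume.restrict (Set.Ioo 0 t)), 0 ≤ t - τ := by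
  filter_upwards [ae_restrict_mem measurableSet_Ioo] with τ hτ
  exact sub_nonneg.mpr hτ.2.le

/-- A seminorm of `ψ` that controls the Duhamel integrand at all times. -/
def duhamelSeminorm (ψ : 𝓢(R3, ℂ)) : ℝ :=
  ∑ _i : Fin 3, ∑ l : Fin 3, ∑ _k : Fin 3,
    (12 * (eLpNorm (freqMul l ψ) 1 volume).toReal +
      12 * (eLpNorm (freqMul l ψ) 2 volume).toReal * bernsteinConst)

theorem continuous_duhamelSeminorm : Continuous duhamelSeminorm := by
  have h : ∀ (p : ℝ≥0∞) [Fact (1 ≤ p)] (l : Fin 3),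
      Continuous fun ψ : 𝓢(R3, ℂ) => (eLpNorm (freqMul l ψ) p volume).toReal := fun p _ l => by
    have h1 : Continuous fun ψ : 𝓢(R3, ℂ) =>
        ‖SchwartzMap.toLpCLM ℂ (E := R3) ℂ p volume (freqMul l ψ)‖ :=
      ((SchwartzMap.toLpCLM ℂ (E := R3) ℂ p volume).continuous.comp (freqMul l).continuous).norm
    refine h1.congr fun ψ => ?_
    rw [SchwartzMap.toLpCLM_apply, Lp.norm_def,
      eLpNorm_congr_ae ((freqMul l ψ).coeFn_toLp p volume)]
  have h1 := h 1
  have h2 := h 2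
  unfold duhamelSeminorm
  fun_prop

theorem duhamelSeminorm_zero : duhamelSeminorm 0 = 0 := by
  simp [duhamelSeminorm]

include hν hu hv

theorem norm_duhamelForm_ae_le (htT : t ≤ T) (ψ : 𝓢(R3, ℂ)) :
    ∀ᵐ τ ∂(volume.restrict (Set.Ioo 0 t)), ‖duhamelForm Φ ν Ω (t - τ) ψ (u τ) (v τ)‖ ≤
      duhamelSeminorm ψ * ((linftyBesovNorm Φ (1 / 2) T u).toReal *
        (linftyBesovNorm Φ (1 / 2) T v).toReal * dyadicSum ^ 2) := by
  filter_upwards [ae_restrict_Ioo_of_le htT (ae_besovNorm_le hu.finite),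
    ae_restrict_Ioo_of_le htT (ae_besovNorm_le hv.finite), ae_restrict_Ioo_sub_nonneg t]
    with τ h1 h2 h3
  exact norm_duhamelForm_le Ω ψ hν.le h3 ENNReal.toReal_nonneg ENNReal.toReal_nonneg h1 h2

theorem integrableOn_duhamelForm (htT : t ≤ T) (ψ : 𝓢(R3, ℂ)) :
    IntegrableOn (fun τ => duhamelForm Φ ν Ω (t - τ) ψ (u τ) (v τ)) (Set.Ioo 0 t) := by
  have hsub : Set.Ioo 0 t ⊆ Set.Ioo 0 T := Set.Ioo_subset_Ioo le_rfl htT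
  have hm : AEStronglyMeasurable (fun τ => duhamelForm Φ ν Ω (t - τ) ψ (u τ) (v τ))
      (volume.restrict (Set.Ioo 0 t)) := by
    refine (aestronglyMeasurable_duhamelForm Ω ψ hν.le (σ := fun τ => t - τ)
      (Continuous.aestronglyMeasurable (by fun_prop))
      (fun m => (hu.aestronglyMeasurable_l2Rep m).mono_measure (Measure.restrict_mono hsub le_rfl))
      (fun m => (hv.aestronglyMeasurable_l2Rep m).mono_measure (Measure.restrict_mono hsub le_rfl))
      ENNReal.toReal_nonneg ENNReal.toReal_nonneg
      (ae_restrict_Ioo_of_le htT (ae_besovNorm_le hu.finite))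
      (ae_restrict_Ioo_of_le htT (ae_besovNorm_le hv.finite))).congr ?_
    filter_upwards [ae_restrict_Ioo_sub_nonneg t] with τ hτ
    rw [max_eq_left hτ]
  exact Integrable.of_bound hm _ (norm_duhamelForm_ae_le Ω hν hu hv htT ψ)

/-- A crude bound that grows with `t`; it serves only to make the functional continuous in `ψ`. -/
theorem norm_duhamelIntegral_le (ht : 0 ≤ t) (htT : t ≤ T) (ψ : 𝓢(R3, ℂ)) :
    ‖duhamelIntegral Φ ν Ω u v t ψ‖ ≤
      duhamelSeminorm ψ * ((linftyBesovNorm Φ (1 / 2) T u).toReal *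
        (linftyBesovNorm Φ (1 / 2) T v).toReal * dyadicSum ^ 2) * t := by
  have h := norm_integral_le_of_norm_le_const (norm_duhamelForm_ae_le Ω hν hu hv htT ψ)
  simpa [duhamelIntegral, Measure.real, ht] using h

theorem duhamelIntegral_add (htT : t ≤ T) (ψ χ : 𝓢(R3, ℂ)) :
    duhamelIntegral Φ ν Ω u v t (ψ + χ)
      = duhamelIntegral Φ ν Ω u v t ψ + duhamelIntegral Φ ν Ω u v t χ := by
  rw [duhamelIntegral, duhamelIntegral, duhamelIntegral,
    ← integral_add (integrableOn_duhamelForm Ω hν hu hv htT ψ)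
      (integrableOn_duhamelForm Ω hν hu hv htT χ)]
  refine integral_congr_ae ?_
  filter_upwards [ae_restrict_Ioo_of_le htT (ae_besovNorm_le hu.finite),
    ae_restrict_Ioo_of_le htT (ae_besovNorm_le hv.finite), ae_restrict_Ioo_sub_nonneg t]
    with τ h1 h2 h3
  exact duhamelForm_add Ω ψ hν.le h3 ENNReal.toReal_nonneg ENNReal.toReal_nonneg h1 h2 χ

theorem duhamelIntegral_smul (htT : t ≤ T) (a : ℂ) (ψ : 𝓢(R3, ℂ)) :
    duhamelIntegral Φ ν Ω u v t (a • ψ) = a • duhamelIntegral Φ ν Ω u v t ψ := by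
  rw [duhamelIntegral, duhamelIntegral, ← integral_smul]
  refine integral_congr_ae ?_
  filter_upwards [ae_restrict_Ioo_of_le htT (ae_besovNorm_le hu.finite),
    ae_restrict_Ioo_of_le htT (ae_besovNorm_le hv.finite), ae_restrict_Ioo_sub_nonneg t]
    with τ h1 h2 h3
  exact duhamelForm_smul Ω ψ hν.le h3 ENNReal.toReal_nonneg ENNReal.toReal_nonneg h1 h2 a

/-- `B(u, v)(t)` exists in `𝒵'`. -/
theorem exists_duhamel (ht : 0 ≤ t) (htT : t ≤ T) :
    ∃ b : ZDual, ∀ ψ : ZSpace, b ψ = duhamelIntegral Φ ν Ω u v t ψ := by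
  let ℓ : ZSpace →ₗ[ℂ] C3 :=
    { toFun := fun ψ => duhamelIntegral Φ ν Ω u v t ψ
      map_add' := fun ψ χ => duhamelIntegral_add Ω hν hu hv htT ψ χ
      map_smul' := fun a ψ => duhamelIntegral_smul Ω hν hu hv htT a ψ }
  have hc : Continuous ℓ := by
    refine continuous_of_continuousAt_zero ℓ ?_
    have h1 : Filter.Tendsto (fun ψ : ZSpace => duhamelSeminorm (ψ : 𝓢(R3, ℂ)) *
        ((linftyBesovNorm Φ (1 / 2) T u).toReal *
        (linftyBesovNorm Φ (1 / 2) T v).toReal * dyadicSum ^ 2) * t) (nhds 0) (nhds 0) := by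
      have h2 : Continuous (fun ψ : ZSpace => duhamelSeminorm (ψ : 𝓢(R3, ℂ)) *
        ((linftyBesovNorm Φ (1 / 2) T u).toReal *
        (linftyBesovNorm Φ (1 / 2) T v).toReal * dyadicSum ^ 2) * t) :=
        ((continuous_duhamelSeminorm.comp continuous_subtype_val).mul continuous_const).mul
          continuous_const
      have h3 := h2.tendsto 0
      simpa [duhamelSeminorm_zero] using h3
    rw [ContinuousAt, map_zero]
    exact squeeze_zero_norm (fun ψ => norm_duhamelIntegral_le Ω hν hu hv ht htT _) h1
  exact ⟨⟨ℓ, hc⟩, fun ψ => rfl⟩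

theorem isBilinear_of_apply (htT : t ≤ T) {b : ZDual}
    (hb : ∀ ψ : ZSpace, b ψ = duhamelIntegral Φ ν Ω u v t ψ) : IsBilinear Φ ν Ω u v t b := by
  refine fun ψ => ⟨?_, integrableOn_duhamelForm Ω hν hu hv htT ψ, hb ψ⟩
  filter_upwards [ae_restrict_Ioo_of_le htT (ae_besovNorm_le hu.finite),
    ae_restrict_Ioo_of_le htT (ae_besovNorm_le hv.finite), ae_restrict_Ioo_sub_nonneg t]
    with τ h1 h2 h3
  exact integrable_duhamelIntegrand Ω _ hν.le h3 ENNReal.toReal_nonneg ENNReal.toReal_nonneg h1 h2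

/-- The clamped integrand is jointly measurable on the square `(0,T)²`. Cutting it off to `τ < t`
gives a fixed domain of integration, and Fubini yields measurability in `t`. -/
theorem aestronglyMeasurable_duhamelIntegral (ψ : 𝓢(R3, ℂ)) :
    AEStronglyMeasurable (fun t => duhamelIntegral Φ ν Ω u v t ψ)
      (volume.restrict (Set.Ioo 0 T)) := by
  set μ : Measure ℝ := volume.restrict (Set.Ioo 0 T) with hμ
  have hq : Measure.QuasiMeasurePreserving (Prod.snd : ℝ × ℝ → ℝ) (μ.prod μ) μ :=
    Measure.quasiMeasurePreserving_snd
  have h1 : AEStronglyMeasurable (fun q : ℝ × ℝ =>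
      duhamelForm Φ ν Ω (max (q.1 - q.2) 0) ψ (u q.2) (v q.2)) (μ.prod μ) :=
    aestronglyMeasurable_duhamelForm Ω ψ hν.le (σ := fun q : ℝ × ℝ => q.1 - q.2)
      (Continuous.aestronglyMeasurable (by fun_prop))
      (u := fun q => u q.2) (v := fun q => v q.2)
      (fun m => (hu.aestronglyMeasurable_l2Rep m).comp_snd)
      (fun m => (hv.aestronglyMeasurable_l2Rep m).comp_snd)
      ENNReal.toReal_nonneg ENNReal.toReal_nonneg
      (hq.ae (ae_besovNorm_le hu.finite)) (hq.ae (ae_besovNorm_le hv.finite))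
  have hS : MeasurableSet {q : ℝ × ℝ | q.2 < q.1} := measurableSet_lt measurable_snd measurable_fst
  have h2 := (h1.indicator hS).integral_prod_right'
  refine h2.congr ?_
  filter_upwards [ae_restrict_mem measurableSet_Ioo] with t ht
  have e : ∀ τ, {q : ℝ × ℝ | q.2 < q.1}.indicator (fun q : ℝ × ℝ =>
      duhamelForm Φ ν Ω (max (q.1 - q.2) 0) ψ (u q.2) (v q.2)) (t, τ)
      = (Set.Iio t).indicator
        (fun τ => duhamelForm Φ ν Ω (max (t - τ) 0) ψ (u τ) (v τ)) τ := fun τ => by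
    by_cases h : τ < t <;> simp [Set.indicator, h]
  simp only [e]
  rw [integral_indicator measurableSet_Iio, hμ, Measure.restrict_restrict measurableSet_Iio]
  have hI : Set.Iio t ∩ Set.Ioo 0 T = Set.Ioo 0 t := by
    ext τ
    simp only [Set.mem_inter_iff, Set.mem_Iio, Set.mem_Ioo]
    exact ⟨fun h => ⟨h.2.1, h.1⟩, fun h => ⟨h.2, h.1, h.2.trans ht.2⟩⟩
  rw [hI, duhamelIntegral]
  refine integral_congr_ae ?_
  filter_upwards [ae_restrict_Ioo_sub_nonneg t] with τ hτ
  rw [max_eq_left hτ]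

theorem norm_duhamelIntegral_deltaS_le {c M : ℝ} (hc : 0 < c) (hT : 0 < T) (hM0 : 0 ≤ M)
    (hM : ∀ j ξ, ‖Φ.symbol j ξ‖ ≤ M) (ht : 0 ≤ t) (htT : t ≤ T) (j : ℤ) (ψ : 𝓢(R3, ℂ)) :
    ‖duhamelIntegral Φ ν Ω u v t (Φ.deltaS j ψ)‖ ≤
      8640 * bernsteinConst * dyadicSum ^ 2 * M *
        (max 1 (9 / 16 * ν / c) / (9 / 16 * ν)) *
        (linftyBesovNorm Φ (1 / 2) T u).toReal * (weightedNorm Φ c T v).toReal *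
        (2 : ℝ) ^ (-(j : ℝ) / 2) * (eLpNorm ψ 2 volume).toReal := by
  set A := (linftyBesovNorm Φ (1 / 2) T u).toReal with hA
  set W := (weightedNorm Φ c T v).toReal with hW
  have hA0 : 0 ≤ A := ENNReal.toReal_nonneg
  have hW0 : 0 ≤ W := ENNReal.toReal_nonneg
  have hE := eWeight_pos hc hT j
  have K0 := bernsteinConst_nonneg
  have hWfin : weightedNorm Φ c T v < ∞ := weightedNorm_le.trans_lt hv.finite
  -- The bound on the blocks of `v` is used with `W / e_{j,T}`; the division disappears against the
  -- factor `e_{j,T}` of the time integral.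
  set Q : ℝ := 8640 * bernsteinConst * dyadicSum ^ 2 * M * A * (W / eWeight c T j) *
    (eLpNorm ψ 2 volume).toReal * ((2 : ℝ) ^ ((j : ℝ) / 2) * (2 : ℝ) ^ j) with hQ
  have hQ0 : 0 ≤ Q := by positivity
  have hae : ∀ᵐ τ ∂(volume.restrict (Set.Ioo 0 t)),
      ‖duhamelForm Φ ν Ω (t - τ) (Φ.deltaS j ψ) (u τ) (v τ)‖ ≤
        Q * Real.exp (-(9 / 16 * ν * (2 : ℝ) ^ (2 * j) * (t - τ))) := by
    filter_upwards [ae_restrict_Ioo_of_le htT (ae_besovNorm_le hu.finite),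
      ae_restrict_Ioo_of_le htT (ae_besovNorm_le hv.finite), ae_restrict_Ioo_sub_nonneg t,
      ae_restrict_Ioo_of_le htT (ae_l2Norm_delta_le_weighted hc hT hWfin)] with τ h1 h2 h3 h4
    exact norm_duhamelForm_deltaS_le Ω ψ hν.le h3 ENNReal.toReal_nonneg ENNReal.toReal_nonneg
      h1 h2 hM0 hM (by positivity) (h4 j)
  have hexp : IntegrableOn (fun τ => Q * Real.exp (-(9 / 16 * ν * (2 : ℝ) ^ (2 * j) * (t - τ))))
      (Set.Ioo 0 t) :=
    (Continuous.integrableOn_Icc (by fun_prop)).mono_set Set.Ioo_subset_Icc_self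
  have h1 := norm_integral_le_of_norm_le hexp hae
  rw [integral_const_mul] at h1
  refine h1.trans ((mul_le_mul_of_nonneg_left (integral_exp_le hν hc ht htT j) hQ0).trans
    (le_of_eq ?_))
  have e : (2 : ℝ) ^ ((j : ℝ) / 2) * (2 : ℝ) ^ j * ((2 : ℝ) ^ (2 * j))⁻¹
      = (2 : ℝ) ^ (-(j : ℝ) / 2) := by
    rw [← zpow_neg, ← Real.rpow_intCast, ← Real.rpow_intCast, ← Real.rpow_add (by norm_num),
      ← Real.rpow_add (by norm_num)]
    congr 1
    push_cast
    ring
  rw [← e, hQ]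
  field_simp

end Duhamel

/-- `b` composed with `deltaZ j` is the distribution `Δ_j b`, which the bound places in `L²` by
Riesz; the `3` counts components. -/
theorem besovNorm_le_of_delta_bound {Φ : LPCutoff} {b : ZDual} {m : ℝ} (hm : 0 ≤ m)
    (h : ∀ (j : ℤ) (ψ : 𝓢(R3, ℂ)),
      ‖b (Φ.deltaZ j ψ)‖ ≤ m * (2 : ℝ) ^ (-(j : ℝ) / 2) * (eLpNorm ψ 2 volume).toReal) :
    besovNorm Φ (1 / 2) b ≤ ENNReal.ofReal (3 * m) := by
  refine iSup_le fun j => ?_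
  have h1 := l2Norm_le_of_bound (Φ.delta j b) (m := m * (2 : ℝ) ^ (-(j : ℝ) / 2))
    (by positivity) (h j)
  rw [two_rpow_ofReal]
  refine (mul_le_mul_right h1 _).trans (le_of_eq ?_)
  rw [← ENNReal.ofReal_mul (by positivity)]
  congr 1
  have : (2 : ℝ) ^ ((j : ℝ) * (1 / 2)) * (2 : ℝ) ^ (-(j : ℝ) / 2) = 1 := by
    rw [← Real.rpow_add (by norm_num)]
    have : (j : ℝ) * (1 / 2) + -(j : ℝ) / 2 = 0 := by ring
    rw [this, Real.rpow_zero]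
  linear_combination (3 * m) * this

end

theorem mainTheorem4 (Φ : LPCutoff) (ν c : ℝ) (hν : 0 < ν) (hc : 0 < c) :
    ∃ C : ℝ≥0, ∀ Ω T : ℝ, 0 < T → ∀ u v : ℝ → ZDual,
      MemLinftyBesov Φ (1 / 2) T u → MemLinftyBesov Φ (1 / 2) T v →
      ∃ b : ℝ → ZDual,
        (∀ t ∈ Set.Icc 0 T, IsBilinear Φ ν Ω u v t (b t)) ∧
        MemLinftyBesov Φ (1 / 2) T b ∧
        linftyBesovNorm Φ (1 / 2) T b ≤
          C * linftyBesovNorm Φ (1 / 2) T u * weightedNorm Φ c T v := by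
  obtain ⟨M, hM0, hM⟩ := Φ.exists_bound
  have K0 := bernsteinConst_nonneg
  set C₀ : ℝ := 8640 * bernsteinConst * dyadicSum ^ 2 * M *
    (max 1 (9 / 16 * ν / c) / (9 / 16 * ν)) with hC₀
  have hC₀0 : 0 ≤ C₀ := by positivity
  refine ⟨(3 * C₀).toNNReal, fun Ω T hT u v hu hv => ?_⟩
  -- Values outside `[0, T]` do not matter; there `b` is unconstrained.
  have hex : ∀ t : ℝ, ∃ b : ZDual, t ∈ Set.Icc 0 T →
      ∀ ψ : ZSpace, b ψ = duhamelIntegral Φ ν Ω u v t ψ := fun t => by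
    by_cases ht : t ∈ Set.Icc 0 T
    · obtain ⟨b, hb⟩ := exists_duhamel Ω hν hu hv ht.1 ht.2
      exact ⟨b, fun _ => hb⟩
    · exact ⟨0, fun h => absurd h ht⟩
  choose b hb using hex
  set A := (linftyBesovNorm Φ (1 / 2) T u).toReal with hA
  set W := (weightedNorm Φ c T v).toReal with hW
  have hA0 : 0 ≤ A := ENNReal.toReal_nonneg
  have hW0 : 0 ≤ W := ENNReal.toReal_nonneg
  have hWfin : weightedNorm Φ c T v < ∞ := weightedNorm_le.trans_lt hv.finite
  have hbound : linftyBesovNorm Φ (1 / 2) T b ≤ ENNReal.ofReal (3 * (C₀ * A * W)) := by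
    refine essSup_le_of_ae_le _ ?_
    filter_upwards [ae_restrict_mem measurableSet_Ioo] with t ht
    refine besovNorm_le_of_delta_bound (by positivity) fun j ψ => ?_
    rw [hb t (Set.Ioo_subset_Icc_self ht)]
    exact norm_duhamelIntegral_deltaS_le Ω hν hu hv hc hT hM0 hM ht.1.le ht.2.le j ψ
  refine ⟨b, fun t ht => isBilinear_of_apply Ω hν hu hv ht.2 (hb t ht), ⟨fun ψ => ?_, ?_⟩, ?_⟩
  · refine (aestronglyMeasurable_duhamelIntegral Ω hν hu hv (ψ : 𝓢(R3, ℂ))).congr ?_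
    filter_upwards [ae_restrict_mem measurableSet_Ioo] with t ht
    exact (hb t (Set.Ioo_subset_Icc_self ht) ψ).symm
  · exact hbound.trans_lt ENNReal.ofReal_lt_top
  · refine hbound.trans (le_of_eq ?_)
    have e1 : linftyBesovNorm Φ (1 / 2) T u = ENNReal.ofReal A :=
      (ENNReal.ofReal_toReal hu.finite.ne).symm
    have e2 : weightedNorm Φ c T v = ENNReal.ofReal W := (ENNReal.ofReal_toReal hWfin.ne).symm
    have e3 : (((3 * C₀).toNNReal : ℝ≥0) : ℝ≥0∞) = ENNReal.ofReal (3 * C₀) := rfl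
    rw [e1, e2, e3, ← ENNReal.ofReal_mul (by positivity), ← ENNReal.ofReal_mul (by positivity)]
    congr 1
    ring
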